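/- Notation. For $m\in\{0,1,2,\dots\}$ and $p\in[0,1]$, $S_m(p)$ denotes a binomial random variable with parameters $m,p$, and $S'$ denotes an independent copy of the family $S$. For an integer $N\ge 1$, $u\in\mathbb R$ and $r>0$ put $$M_N(u,r)=\Big\lfloor Nr+Nr\,\frac{u}{N^{1/2}}\Big\rfloor ,$$ and for $x=(x_1,x_2),\,y=(y_1,y_2)\in\mathbb R^2$, $0<s\le t$ and $0\le r\le s$, $$\mathfrak b_N(x,y;r,s,t)=\prod_{j=1}^2 N^{1/2}\,\mathbf P\Big(S_{M_N(x_j,s)}\big(\tfrac rs\big)=S'_{M_N(y_j,t)}\big(\tfrac rt\big)\Big),$$ which is defined for all $N$ so large that $M_N(x_j,s),M_N(y_j,t)\ge 0$ for $j=1,2$. Let $Q_t(x,y)=\frac1{2\pi t}e^{-|x-y|^2/(2t)}$, $t>0$, be the transition density of the standard Brownian motion in $\mathbb R^2$. Fix $\eta\in(0,1/2)$ and put $\ell_N=N^{-(1/2+\eta)}$, $r_N=1-\ell_N$. Theorem 3.20. (1°) For all $0<s<t<\infty$ and $x,y\in\mathbb R^2$, $$\lim_{N\to\infty}\int_{s\ell_N}^{s}\Big(\mathfrak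 b_N(x,y;r,s,t)-\frac{\mathbf 1_{[1,\infty)}(Nr)}{4\pi r}\Big)\,dr+\frac{\ln s}{4\pi}-\int_0^\infty\frac{e^{-\frac1{4v}}-\mathbf 1_{[1,\infty)}(v)}{4\pi v}\,dv$$ $$=\frac1{2\pi}\int_{\mathbb R^2}\int_{\mathbb R^2}Q_{s^{-1}}(y',x)\,\big(-\ln|y'-y''|\big)\,Q_{t^{-1}}(y'',y)\,dy'\,dy''+\int_0^{t^{-1}}\int_{\mathbb R^2}Q_{s^{-1}-r}(z,x)\,Q_{t^{-1}-r}(z,y)\,dz\,dr .$$ (2°) For all $s=t\in(0,\infty)$ and $x,y\in\mathbb R^2$ with $x\ne y$, the same identity holds if the upper limit $s$ of the integral under $\lim_{N\to\infty}$ is replaced by $sr_N$. In both cases the integral over $v\in(0,\infty)$, the integral over $(y',y'')$ and the integral over $(r,z)$ converge absolutely. -/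

import Mathlib

open MeasureTheory Filter Topology

namespace IntegratedNormal

noncomputable section

/-- The Euclidean plane, with the Euclidean norm and Lebesgue measure. -/
abbrev Plane : Type := EuclideanSpace ℝ (Fin 2)

/-- `P(S_m(p) = S'_{m'}(p'))` for independent binomial random variables `S_m(p)`, `S'_{m'}(p')`.
The parameters `p, p'` are probabilities; real arguments outside `[0,1]` are projected onto `[0,1]`
(they never occur in the ranges of integration that are considered). -/
def binomialCoincidence (m m' : ℕ) (p p' : ℝ) : ℝ :=
  ((ProbabilityTheory.binomial m (Set.projIcc (0 : ℝ) 1 zero_le_one p)).prod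
    (ProbabilityTheory.binomial m' (Set.projIcc (0 : ℝ) 1 zero_le_one p'))).real
      {z : ℕ × ℕ | z.1 = z.2}

/-- `M_N(u, r) = ⌊N r + N r u / N^{1/2}⌋`. It is used as the number of trials of a binomial random
variable, for which it has to be nonnegative; given `u` and `r > 0`, this is so for all large `N`
(for the other `N` the value below is `0`). -/
def trials (N : ℕ) (u r : ℝ) : ℕ :=
  ⌊(N : ℝ) * r + (N : ℝ) * r * (u / √(N : ℝ))⌋₊

/-- The rescaled binomial kernel in one coordinate:
`N^{1/2} P(S_{M(a,u)}(r/u) = S'_{M(b,v)}(r/v))`. -/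
def binomialKernelCoord (N : ℕ) (a b r u v : ℝ) : ℝ :=
  √(N : ℝ) * binomialCoincidence (trials N a u) (trials N b v) (r / u) (r / v)

/-- The rescaled binomial kernel: the product of the kernels of the two coordinates. -/
def binomialKernel (N : ℕ) (x y : Plane) (r u v : ℝ) : ℝ :=
  ∏ j : Fin 2, binomialKernelCoord N (x j) (y j) r u v

/-- The transition density of the two-dimensional standard Brownian motion. -/
def heatKernel (t : ℝ) (x y : Plane) : ℝ :=
  (1 / (2 * Real.pi * t)) * Real.exp (-(‖x - y‖ ^ 2) / (2 * t))

/-- The indicator function of `[1, ∞)`. -/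
def indicatorGeOne (v : ℝ) : ℝ := Set.indicator (Set.Ici (1 : ℝ)) (fun _ => (1 : ℝ)) v

/-- `ℓ_N = N^{-(1/2+η)}`. -/
def ell (η : ℝ) (N : ℕ) : ℝ := (N : ℝ) ^ (-(1 / 2 + η))

/-- `r_N = 1 - ℓ_N`. -/
def rN (η : ℝ) (N : ℕ) : ℝ := 1 - ell η N

/-- The kernel minus its singular part, as a function of `r`. -/
def centeredKernel (N : ℕ) (x y : Plane) (s t r : ℝ) : ℝ :=
  binomialKernel N x y r s t - indicatorGeOne ((N : ℝ) * r) / (4 * Real.pi * r)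

/-- The integrand of the subtracted constant. -/
def constIntegrand (v : ℝ) : ℝ :=
  (Real.exp (-(1 / (4 * v))) - indicatorGeOne v) / (4 * Real.pi * v)

/-- The integrand of the logarithmic term, as a function of `(y', y'')`. -/
def logIntegrand (s t : ℝ) (x y : Plane) (y' y'' : Plane) : ℝ :=
  heatKernel (1 / s) y' x * (-Real.log ‖y' - y''‖) * heatKernel (1 / t) y'' y

/-- The integrand of the heat kernel term, as a function of `(r, z)`. -/
def heatIntegrand (s t : ℝ) (x y : Plane) (r : ℝ) (z : Plane) : ℝ :=
  heatKernel (1 / s - r) z x * heatKernel (1 / t - r) z y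

end

end IntegratedNormal

namespace IntegratedNormal

/-! Put `q = r (2 - r/s - r/t)`, `τ = 1/s + 1/t`, `δ = 1/s - 1/t`. The theorem splits into an error
estimate for the binomial kernel and an exact computation with its Gaussian limit.

Error estimate. Fourier inversion gives a local limit theorem with error `C / V`, uniform in all
binomial parameters, where `V` is the total variance (`exists_binomialCoincidence_sub_gauss_le`). In
each coordinate `V` is of order `N q`, so the kernel differs from `limitKernel` by `O(N^{-1/2}
q^{-3/2})` (`exists_binomialKernel_approx`). As `q` is at least of order `ℓ_N` on the range of
integration, the integrated error is `O(N^{-1/2} ℓ_N^{-1/2}) = O(N^{-(1/4 - η/2)})`, which vanishes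
because `η < 1/2`.

Exact computation. The substitution `w = 2/r - τ` turns `limitKernel` into half the heat kernel at
time `w` between `x` and `y`, with `w` running from about `δ` up to a cutoff. On the right-hand
side, Chapman-Kolmogorov makes the heat term half the integral of the same function over `[δ, τ]`.
The logarithm is a regularised time integral of heat kernels; averaging it over the two Gaussians
shifts time by `τ`, so the logarithmic term is the regularised integral over `[τ, ∞)` minus the
constant. The two pieces join at `τ`, and the logarithms of the cutoffs cancel. -/

/-! ### Local limit theorem for two binomial variables. -/

/-- The coincidence probability as a finite sum. -/
lemma binomialCoincidence_eq_sum (m m' : ℕ) (p p' : ℝ) :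
    binomialCoincidence m m' p p' =
      ∑ k ∈ Finset.range (m + 1),
        ((m.choose k : ℝ) * (Set.projIcc (0 : ℝ) 1 zero_le_one p : ℝ) ^ k *
          (1 - (Set.projIcc (0 : ℝ) 1 zero_le_one p : ℝ)) ^ (m - k)) *
        ((m'.choose k : ℝ) * (Set.projIcc (0 : ℝ) 1 zero_le_one p' : ℝ) ^ k *
          (1 - (Set.projIcc (0 : ℝ) 1 zero_le_one p' : ℝ)) ^ (m' - k)) := by
  unfold binomialCoincidence
  rw [← integral_indicator_one (MeasurableSet.of_discrete), integral_prod _ (by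
    refine (integrable_indicator_iff MeasurableSet.of_discrete).2 ?_
    exact (integrable_const (1 : ℝ)).integrableOn)]
  have h (k : ℕ) : ∫ y, Set.indicator {z : ℕ × ℕ | z.1 = z.2} (1 : ℕ × ℕ → ℝ) (k, y)
      ∂(ProbabilityTheory.binomial m' (Set.projIcc (0 : ℝ) 1 zero_le_one p')) =
      (ProbabilityTheory.binomial m' (Set.projIcc (0 : ℝ) 1 zero_le_one p')).real {k} := by
    rw [← integral_indicator_one (MeasurableSet.of_discrete)]
    congr 1
    ext y
    simp [Set.indicator_apply, eq_comm]
  simp_rw [h, ProbabilityTheory.binomial_real_singleton]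
  rw [ProbabilityTheory.integral_binomial, Nat.range_succ_eq_Iic]
  simp [smul_eq_mul]

lemma continuous_binomialCoincidence (m m' : ℕ) {f g : ℝ → ℝ} (hf : Continuous f)
    (hg : Continuous g) : Continuous fun r => binomialCoincidence m m' (f r) (g r) := by
  simp_rw [binomialCoincidence_eq_sum]
  have h : Continuous fun p : ℝ => (Set.projIcc (0 : ℝ) 1 zero_le_one p : ℝ) :=
    continuous_subtype_val.comp continuous_projIcc
  have h1 := h.comp hf
  have h2 := h.comp hg
  simp only [Function.comp_def] at h1 h2
  fun_prop

/-- The telescoping bound `n ‖a - b‖ ρ^(n-1)`, multiplied by `ρ` to avoid the truncated exponent `n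
- 1`. -/
lemma norm_pow_sub_pow_mul_le {a b : ℂ} {ρ : ℝ} (ha : ‖a‖ ≤ ρ) (hb : ‖b‖ ≤ ρ) (n : ℕ) :
    ρ * ‖a ^ n - b ^ n‖ ≤ n * ‖a - b‖ * ρ ^ n := by
  have hρ : 0 ≤ ρ := (norm_nonneg a).trans ha
  induction n with
  | zero => simp
  | succ n ih =>
    have h1 : a ^ (n + 1) - b ^ (n + 1) = a ^ n * (a - b) + (a ^ n - b ^ n) * b := by ring
    have h2 : ‖a ^ n‖ ≤ ρ ^ n := by rw [norm_pow]; gcongr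
    calc ρ * ‖a ^ (n + 1) - b ^ (n + 1)‖
        ≤ ρ * (‖a ^ n‖ * ‖a - b‖ + ‖a ^ n - b ^ n‖ * ‖b‖) := by
          rw [h1, ← norm_mul, ← norm_mul]; gcongr; exact norm_add_le _ _
      _ ≤ ρ * (ρ ^ n * ‖a - b‖ + ‖a ^ n - b ^ n‖ * ρ) := by gcongr
      _ = ρ * ρ ^ n * ‖a - b‖ + (ρ * ‖a ^ n - b ^ n‖) * ρ := by ring
      _ ≤ ρ * ρ ^ n * ‖a - b‖ + (n * ‖a - b‖ * ρ ^ n) * ρ := by gcongr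
      _ = _ := by push_cast; ring

/-- The characteristic function of a Bernoulli variable. -/
noncomputable def bernoulliChar (p θ : ℝ) : ℂ := 1 - p + p * Complex.exp (θ * Complex.I)

/-- The characteristic function of the normal law with the mean and variance of a Bernoulli
variable. -/
noncomputable def bernoulliGauss (p θ : ℝ) : ℂ :=
  Complex.exp (p * θ * Complex.I - p * (1 - p) * θ ^ 2 / 2)

lemma norm_bernoulliGauss (p θ : ℝ) :
    ‖bernoulliGauss p θ‖ = Real.exp (-(p * (1 - p) * θ ^ 2 / 2)) := by
  rw [bernoulliGauss, Complex.norm_exp]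
  congr 1
  have : (p * θ * Complex.I - p * (1 - p) * θ ^ 2 / 2 : ℂ) =
    ((-(p * (1 - p) * θ ^ 2 / 2) : ℝ) : ℂ) + ((p * θ : ℝ) : ℂ) * Complex.I := by
    push_cast; ring
  rw [this, Complex.add_re, Complex.ofReal_re, Complex.re_ofReal_mul]
  simp

/-- The squared modulus is `1 - 2 p (1 - p) (1 - cos θ)`, and `1 - cos θ ≥ 2 θ² / π² ≥ θ² / 5` on
`[-π, π]`. -/
lemma norm_bernoulliChar_le {p θ : ℝ} (h0 : 0 ≤ p) (h1 : p ≤ 1) (hθ : |θ| ≤ Real.pi) :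
    ‖bernoulliChar p θ‖ ≤ Real.exp (-(p * (1 - p) * θ ^ 2 / 5)) := by
  have hv : 0 ≤ p * (1 - p) := mul_nonneg h0 (by linarith)
  have hsq : ‖bernoulliChar p θ‖ ^ 2 = 1 - 2 * (p * (1 - p)) * (1 - Real.cos θ) := by
    rw [bernoulliChar, Complex.exp_mul_I, ← Complex.normSq_eq_norm_sq, Complex.normSq_apply]
    simp [← Complex.ofReal_cos, ← Complex.ofReal_sin]
    nlinarith [Real.sin_sq_add_cos_sq θ]
  have hcos := Real.cos_le_one_sub_mul_cos_sq hθ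
  have hpi : (1 : ℝ) / 5 ≤ 2 / Real.pi ^ 2 := by
    rw [div_le_div_iff₀ (by norm_num) (by positivity)]
    nlinarith [Real.pi_lt_d2, Real.pi_pos]
  have hc : θ ^ 2 / 5 ≤ 1 - Real.cos θ := by nlinarith [sq_nonneg θ]
  refine le_of_sq_le_sq ?_ (Real.exp_pos _).le
  rw [hsq, ← Real.exp_nat_mul]
  refine le_trans ?_ (Real.add_one_le_exp _)
  push_cast
  nlinarith

lemma norm_exp_mul_I_sub_le {x : ℝ} (hx : |x| ≤ Real.pi) :
    ‖Complex.exp (x * Complex.I) - (1 + x * Complex.I - x ^ 2 / 2)‖ ≤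
      Real.exp Real.pi * |x| ^ 3 := by
  have h := Complex.norm_exp_sub_sum_le_norm_mul_exp (x * Complex.I) 3
  have hn : ‖(x * Complex.I : ℂ)‖ = |x| := by simp
  rw [hn] at h
  have hs : ∑ k ∈ Finset.range 3, (x * Complex.I : ℂ) ^ k / (k.factorial : ℂ) =
      1 + x * Complex.I - x ^ 2 / 2 := by
    simp [Finset.sum_range_succ, mul_pow]
    ring
  rw [hs] at h
  refine h.trans ?_
  rw [mul_comm]
  gcongr

/-- After factoring out `e^{ipθ}` the Bernoulli variable is centred, so the moments up to order two
agree and a cubic remainder is left. The third absolute moment is at most `p (1 - p)`; keeping this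
factor is what makes the final error uniform in `p`. -/
lemma norm_bernoulliChar_sub_le {p θ : ℝ} (h0 : 0 ≤ p) (h1 : p ≤ 1) (hθ : |θ| ≤ Real.pi) :
    ‖bernoulliChar p θ - bernoulliGauss p θ‖ ≤
      (Real.exp Real.pi + 1) * (p * (1 - p)) * |θ| ^ 3 := by
  have hq : 0 ≤ 1 - p := by linarith
  set v := p * (1 - p) with hv
  have hv0 : 0 ≤ v := mul_nonneg h0 hq
  have hv1 : v ≤ 1 / 4 := by nlinarith [sq_nonneg (p - 1 / 2)]
  have e1 : bernoulliChar p θ - bernoulliGauss p θ = Complex.exp (((p * θ : ℝ) : ℂ) * Complex.I) *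
      ((1 - p) * (Complex.exp (((-(p * θ) : ℝ) : ℂ) * Complex.I) -
          (1 + ((-(p * θ) : ℝ) : ℂ) * Complex.I - ((-(p * θ) : ℝ) : ℂ) ^ 2 / 2)) +
        p * (Complex.exp ((((1 - p) * θ : ℝ) : ℂ) * Complex.I) -
          (1 + (((1 - p) * θ : ℝ) : ℂ) * Complex.I - (((1 - p) * θ : ℝ) : ℂ) ^ 2 / 2)) -
        ((Real.exp (-(v * θ ^ 2 / 2)) - 1 - (-(v * θ ^ 2 / 2)) : ℝ) : ℂ)) := by
    have a1 : bernoulliChar p θ = Complex.exp (((p * θ : ℝ) : ℂ) * Complex.I) *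
      ((1 - p) * Complex.exp (((-(p * θ) : ℝ) : ℂ) * Complex.I) +
        p * Complex.exp ((((1 - p) * θ : ℝ) : ℂ) * Complex.I)) := by
      rw [mul_add, mul_left_comm, mul_left_comm _ (p : ℂ), ← Complex.exp_add, ← Complex.exp_add,
        bernoulliChar]
      congr 1
      · rw [← add_mul]; simp
      · congr 2
        push_cast; ring
    have a2 : bernoulliGauss p θ = Complex.exp (((p * θ : ℝ) : ℂ) * Complex.I) *
        ((Real.exp (-(v * θ ^ 2 / 2)) : ℝ) : ℂ) := by
      rw [Complex.ofReal_exp, ← Complex.exp_add, bernoulliGauss]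
      congr 1
      rw [hv]; push_cast; ring
    rw [a1, a2, ← mul_sub]
    congr 1
    rw [hv]; push_cast
    have hI : Complex.I ^ 2 = -1 := Complex.I_sq
    ring_nf
  have b1 : |-(p * θ)| ≤ Real.pi := by
    rw [abs_neg, abs_mul, abs_of_nonneg h0]; nlinarith [abs_nonneg θ]
  have b2 : |(1 - p) * θ| ≤ Real.pi := by
    rw [abs_mul, abs_of_nonneg hq]; nlinarith [abs_nonneg θ]
  have c1 := norm_exp_mul_I_sub_le b1
  have c2 := norm_exp_mul_I_sub_le b2
  have c3 : ‖((Real.exp (-(v * θ ^ 2 / 2)) - 1 - (-(v * θ ^ 2 / 2)) : ℝ) : ℂ)‖ ≤ v * |θ| ^ 3 := by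
    have hth : |θ| ≤ 4 := hθ.trans Real.pi_le_four
    have hx : 0 ≤ v * θ ^ 2 / 2 := by positivity
    have hsq : θ ^ 2 = |θ| ^ 2 := (sq_abs θ).symm
    -- A small exponent allows the quadratic Taylor bound; a large one forces `|θ| > 2`, since `v ≤
    -- 1/4`, and then crude bounds suffice.
    have hx1 : ‖-(v * θ ^ 2 / 2)‖ ≤ 1 ∨ 1 < v * θ ^ 2 / 2 := by
      rw [norm_neg, Real.norm_of_nonneg hx]; exact le_or_gt _ _
    rw [Complex.norm_real]
    rcases hx1 with hx1 | hx1
    · refine (Real.norm_exp_sub_one_sub_id_le hx1).trans ?_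
      rw [norm_neg, Real.norm_of_nonneg hx, hsq]
      have : (v * |θ| ^ 2 / 2) ^ 2 = (v * |θ|^3) * (v * |θ|) / 4 := by ring
      rw [this]
      have : v * |θ| ≤ 1 := by nlinarith [abs_nonneg θ]
      have : 0 ≤ v * |θ| ^ 3 := by positivity
      nlinarith
    · have hθ2 : 2 < |θ| := by
        by_contra! hc
        have : |θ| ^ 2 ≤ 4 := by nlinarith [abs_nonneg θ]
        nlinarith
      have e : Real.exp (-(v * θ ^ 2 / 2)) ≤ 1 := by rw [Real.exp_le_one_iff]; linarith
      have e' := Real.exp_pos (-(v * θ ^ 2 / 2))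
      rw [Real.norm_eq_abs, abs_le]
      have : v * θ ^ 2 ≤ v * |θ| ^ 3 := by
        rw [hsq]; gcongr <;> linarith
      constructor <;> linarith
  have n1 : ‖(1 - p : ℂ)‖ = 1 - p := by
    rw [← Complex.ofReal_one, ← Complex.ofReal_sub, Complex.norm_of_nonneg hq]
  have n2 : ‖(p : ℂ)‖ = p := Complex.norm_of_nonneg h0
  rw [e1, norm_mul, Complex.norm_exp_ofReal_mul_I, one_mul]
  refine (norm_sub_le _ _).trans ?_
  refine (add_le_add ((norm_add_le _ _).trans (add_le_add (norm_mul_le _ _) (norm_mul_le _ _)))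
    c3).trans ?_
  rw [n1, n2]
  have hE := Real.exp_pos Real.pi
  rw [abs_neg, abs_mul, abs_of_nonneg h0] at c1
  rw [abs_mul, abs_of_nonneg hq] at c2
  have d1 := mul_le_mul_of_nonneg_left c1 hq
  have d2 := mul_le_mul_of_nonneg_left c2 h0
  have key : (1 - p) * (Real.exp Real.pi * (p * |θ|) ^ 3) +
      p * (Real.exp Real.pi * ((1 - p) * |θ|) ^ 3) ≤ Real.exp Real.pi * v * |θ| ^ 3 := by
    have : (1 - p) * (Real.exp Real.pi * (p * |θ|) ^ 3) +
      p * (Real.exp Real.pi * ((1 - p) * |θ|) ^ 3) =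
      Real.exp Real.pi * v * |θ| ^ 3 * (1 - 2 * v) := by rw [hv]; ring
    rw [this]
    have : 0 ≤ Real.exp Real.pi * v * |θ| ^ 3 := by positivity
    nlinarith
  linarith

lemma integral_exp_int_mul (j : ℤ) :
    ∫ θ in (-Real.pi)..Real.pi, Complex.exp ((j : ℂ) * (θ * Complex.I)) =
      if j = 0 then 2 * (Real.pi : ℂ) else 0 := by
  split_ifs with hj
  · simp [hj]; ring
  · have hc : (j : ℂ) * Complex.I ≠ 0 := by simp [hj]
    have h := integral_exp_mul_complex (a := -Real.pi) (b := Real.pi) hc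
    have e : ∀ θ : ℝ, (j : ℂ) * (θ * Complex.I) = (j : ℂ) * Complex.I * θ := fun θ => by ring
    simp_rw [e, h]
    have : Complex.exp ((j : ℂ) * Complex.I * (Real.pi : ℝ)) =
        Complex.exp ((j : ℂ) * Complex.I * ((-Real.pi : ℝ) : ℂ)) := by
      rw [Complex.exp_eq_exp_iff_exists_int]
      exact ⟨j, by push_cast; ring⟩
    rw [this, sub_self, zero_div]

lemma bernoulliChar_pow (p θ : ℝ) (m : ℕ) :
    bernoulliChar p θ ^ m = ∑ k ∈ Finset.range (m + 1),
      (((m.choose k : ℝ) * p ^ k * (1 - p) ^ (m - k) : ℝ) : ℂ) *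
        Complex.exp ((k : ℂ) * (θ * Complex.I)) := by
  rw [bernoulliChar, add_comm, add_pow]
  refine Finset.sum_congr rfl fun k _ => ?_
  rw [mul_pow, ← Complex.exp_nat_mul]
  push_cast
  ring

/-- The probability generating polynomials recover the coincidence probability by Fourier
inversion. -/
lemma integral_bernoulliChar (m m' : ℕ) (p p' : ℝ) :
    ∫ θ in (-Real.pi)..Real.pi, bernoulliChar p θ ^ m * bernoulliChar p' (-θ) ^ m' =
      2 * (Real.pi : ℂ) * ((∑ k ∈ Finset.range (m + 1),
        ((m.choose k : ℝ) * p ^ k * (1 - p) ^ (m - k)) *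
        ((m'.choose k : ℝ) * p' ^ k * (1 - p') ^ (m' - k)) : ℝ) : ℂ) := by
  set c : ℕ → ℝ := fun k => (m.choose k : ℝ) * p ^ k * (1 - p) ^ (m - k) with hc
  set d : ℕ → ℝ := fun k => (m'.choose k : ℝ) * p' ^ k * (1 - p') ^ (m' - k) with hd
  have e : ∀ θ : ℝ, bernoulliChar p θ ^ m * bernoulliChar p' (-θ) ^ m' =
      ∑ k ∈ Finset.range (m + 1), ∑ l ∈ Finset.range (m' + 1),
        ((c k : ℂ) * d l) * Complex.exp ((((k : ℤ) - l : ℤ) : ℂ) * (θ * Complex.I)) := by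
    intro θ
    rw [bernoulliChar_pow, bernoulliChar_pow, Finset.sum_mul_sum]
    refine Finset.sum_congr rfl fun k _ => Finset.sum_congr rfl fun l _ => ?_
    have : Complex.exp ((((k : ℤ) - l : ℤ) : ℂ) * (θ * Complex.I)) =
        Complex.exp ((k : ℂ) * (θ * Complex.I)) *
          Complex.exp ((l : ℂ) * (((-θ : ℝ) : ℂ) * Complex.I)) := by
      rw [← Complex.exp_add]; congr 1; push_cast; ring
    rw [this]
    simp only [hc, hd]
    ring
  simp_rw [e]
  rw [intervalIntegral.integral_finsetSum (fun k _ =>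
    (Continuous.intervalIntegrable (by fun_prop) _ _))]
  rw [Complex.ofReal_sum, Finset.mul_sum]
  refine Finset.sum_congr rfl fun k _ => ?_
  rw [intervalIntegral.integral_finsetSum (fun l _ =>
    (Continuous.intervalIntegrable (by fun_prop) _ _))]
  simp_rw [intervalIntegral.integral_const_mul, integral_exp_int_mul]
  rw [Finset.sum_eq_single k]
  · simp only [sub_self, if_true, hc, hd]; push_cast; ring
  · intro l _ hl
    rw [if_neg (by omega), mul_zero]
  -- If the diagonal index lies beyond `m'`, the second binomial coefficient vanishes, so summing
  -- over `k ≤ m` alone loses nothing.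
  · intro hk
    have : d k = 0 := by
      simp only [hd]
      rw [Nat.choose_eq_zero_of_lt (by simpa using hk)]; simp
    rw [this]; simp

/-- Telescoping produces `V |θ|³ exp(-V θ² / 5)`, with `V` the total variance. Half of the
exponential decay absorbs `V θ²`, which leaves a function of `θ` whose integral is of order `1 / V`.
-/
lemma norm_char_sub_gauss_le {p p' : ℝ} (h0 : 0 ≤ p) (h1 : p ≤ 1) (h0' : 0 ≤ p') (h1' : p' ≤ 1)
    (m m' : ℕ) {θ : ℝ} (hθ : |θ| ≤ Real.pi) :
    ‖bernoulliChar p θ ^ m * bernoulliChar p' (-θ) ^ m' -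
        bernoulliGauss p θ ^ m * bernoulliGauss p' (-θ) ^ m'‖ ≤
      20 * (Real.exp Real.pi + 1) * (|θ| *
        Real.exp (-((m * (p * (1 - p)) + m' * (p' * (1 - p'))) / 10 * θ ^ 2))) := by
  set K := Real.exp Real.pi + 1 with hK
  have hK0 : 0 < K := by positivity
  have one (p θ : ℝ) (h0 : 0 ≤ p) (h1 : p ≤ 1) (hθ : |θ| ≤ Real.pi) (n : ℕ) :
      ‖bernoulliChar p θ ^ n - bernoulliGauss p θ ^ n‖ ≤
        2 * n * (K * (p * (1 - p)) * |θ| ^ 3) * Real.exp (-(n * (p * (1 - p)) * θ ^ 2 / 5)) ∧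
      ‖bernoulliChar p θ ^ n‖ ≤ Real.exp (-(n * (p * (1 - p)) * θ ^ 2 / 5)) ∧
      ‖bernoulliGauss p θ ^ n‖ ≤ Real.exp (-(n * (p * (1 - p)) * θ ^ 2 / 5)) := by
    have hv : 0 ≤ p * (1 - p) := mul_nonneg h0 (by linarith)
    have hv4 : p * (1 - p) ≤ 1 / 4 := by nlinarith [sq_nonneg (p - 1 / 2)]
    set ρ := Real.exp (-(p * (1 - p) * θ ^ 2 / 5)) with hρ
    have hρn : Real.exp (-(n * (p * (1 - p)) * θ ^ 2 / 5)) = ρ ^ n := by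
      rw [hρ, ← Real.exp_nat_mul]; congr 1; ring
    have ha : ‖bernoulliChar p θ‖ ≤ ρ := norm_bernoulliChar_le h0 h1 hθ
    have hb : ‖bernoulliGauss p θ‖ ≤ ρ := by
      rw [norm_bernoulliGauss, hρ]
      apply Real.exp_le_exp.2
      nlinarith [mul_nonneg hv (sq_nonneg θ)]
    rw [hρn]
    refine ⟨?_, by rw [norm_pow]; gcongr, by rw [norm_pow]; gcongr⟩
    -- Dividing the telescoping bound by `ρ` therefore costs only a factor `2`.
    have hρ2 : 1 / 2 ≤ ρ := by
      have : θ ^ 2 ≤ 10 := by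
        rw [← sq_abs]; nlinarith [Real.pi_lt_d2, abs_nonneg θ]
      have h3 := Real.add_one_le_exp (-(p * (1 - p) * θ ^ 2 / 5))
      have : p * (1 - p) * θ ^ 2 ≤ 1 / 4 * 10 := by gcongr
      linarith
    have h := norm_pow_sub_pow_mul_le ha hb n
    have hd := norm_bernoulliChar_sub_le h0 h1 hθ
    have : n * ‖bernoulliChar p θ - bernoulliGauss p θ‖ * ρ ^ n ≤
        n * (K * (p * (1 - p)) * |θ| ^ 3) * ρ ^ n := by gcongr
    nlinarith [norm_nonneg (bernoulliChar p θ ^ n - bernoulliGauss p θ ^ n)]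
  obtain ⟨a1, a2, a3⟩ := one p θ h0 h1 hθ m
  obtain ⟨b1, b2, b3⟩ := one p' (-θ) h0' h1' (by rwa [abs_neg]) m'
  rw [neg_sq, abs_neg] at *
  have hv : 0 ≤ p * (1 - p) := mul_nonneg h0 (by linarith)
  have hv' : 0 ≤ p' * (1 - p') := mul_nonneg h0' (by linarith)
  set v := p * (1 - p)
  set v' := p' * (1 - p')
  set V := m * v + m' * v' with hV
  have hV0 : 0 ≤ V := by positivity
  have e1 : bernoulliChar p θ ^ m * bernoulliChar p' (-θ) ^ m' -
        bernoulliGauss p θ ^ m * bernoulliGauss p' (-θ) ^ m' =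
      (bernoulliChar p θ ^ m - bernoulliGauss p θ ^ m) * bernoulliChar p' (-θ) ^ m' +
      bernoulliGauss p θ ^ m * (bernoulliChar p' (-θ) ^ m' - bernoulliGauss p' (-θ) ^ m') := by ring
  have e2 : Real.exp (-(m * v * θ ^ 2 / 5)) * Real.exp (-(m' * v' * θ ^ 2 / 5)) =
      Real.exp (-(V * θ ^ 2 / 5)) := by
    rw [← Real.exp_add]; congr 1; rw [hV]; ring
  have e3 : V * θ ^ 2 * Real.exp (-(V * θ ^ 2 / 5)) ≤ 10 * Real.exp (-(V / 10 * θ ^ 2)) := by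
    have h := Real.add_one_le_exp (V * θ ^ 2 / 10)
    have e : Real.exp (-(V / 10 * θ ^ 2)) =
        Real.exp (V * θ ^ 2 / 10) * Real.exp (-(V * θ ^ 2 / 5)) := by
      rw [← Real.exp_add]; congr 1; ring
    rw [e, ← mul_assoc]
    exact mul_le_mul_of_nonneg_right (by linarith) (Real.exp_pos _).le
  calc _ ≤ 2 * m * (K * v * |θ| ^ 3) * Real.exp (-(m * v * θ ^ 2 / 5)) *
        Real.exp (-(m' * v' * θ ^ 2 / 5)) + Real.exp (-(m * v * θ ^ 2 / 5)) *
        (2 * m' * (K * v' * |θ| ^ 3) * Real.exp (-(m' * v' * θ ^ 2 / 5))) := by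
        rw [e1]
        refine (norm_add_le _ _).trans ?_
        rw [norm_mul, norm_mul]
        gcongr
    _ = 2 * K * |θ| ^ 3 * V * (Real.exp (-(m * v * θ ^ 2 / 5)) *
        Real.exp (-(m' * v' * θ ^ 2 / 5))) := by rw [hV]; ring
    _ = 2 * K * |θ| * (V * θ ^ 2 * Real.exp (-(V * θ ^ 2 / 5))) := by
        rw [e2, ← sq_abs θ]; ring
    _ ≤ 2 * K * |θ| * (10 * Real.exp (-(V / 10 * θ ^ 2))) := by gcongr
    _ = _ := by ring

lemma integrable_abs_mul_exp_neg_mul_sq {b : ℝ} (hb : 0 < b) :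
    Integrable fun x : ℝ => |x| * Real.exp (-(b * x ^ 2)) := by
  have h := (integrable_mul_exp_neg_mul_sq hb).norm
  refine h.congr (ae_of_all _ fun x => ?_)
  simp

lemma integral_abs_mul_exp_neg_mul_sq {b : ℝ} (hb : 0 < b) :
    ∫ x : ℝ, |x| * Real.exp (-(b * x ^ 2)) = 1 / b := by
  have h : ∫ x : ℝ, |x| * Real.exp (-(b * |x| ^ 2)) =
      2 * ∫ x in Set.Ioi (0 : ℝ), x * Real.exp (-(b * x ^ 2)) :=
    integral_comp_abs (f := fun x => x * Real.exp (-(b * x ^ 2)))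
  simp_rw [sq_abs] at h
  rw [h]
  have h2 := integral_mul_cexp_neg_mul_sq (b := (b : ℂ)) (by simpa using hb)
  have h3 : ∫ x in Set.Ioi (0 : ℝ), (x : ℂ) * Complex.exp (-(b : ℂ) * (x : ℂ) ^ 2) =
      ((∫ x in Set.Ioi (0 : ℝ), x * Real.exp (-(b * x ^ 2)) : ℝ) : ℂ) := by
    rw [← integral_complex_ofReal]
    refine integral_congr_ae (ae_of_all _ fun x => ?_)
    push_cast; ring_nf
  rw [h3] at h2
  have h4 : (∫ x in Set.Ioi (0 : ℝ), x * Real.exp (-(b * x ^ 2))) = (2 * b)⁻¹ := by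
    exact_mod_cast h2
  rw [h4]; field_simp

/-- A local central limit theorem for the difference of two independent binomial variables, with an
error bound that is uniform in all parameters. -/
lemma exists_binomialCoincidence_sub_gauss_le : ∃ C : ℝ, 0 < C ∧ ∀ (m m' : ℕ) (p p' : ℝ),
    0 ≤ p → p ≤ 1 → 0 ≤ p' → p' ≤ 1 → 0 < m * (p * (1 - p)) + m' * (p' * (1 - p')) →
    |binomialCoincidence m m' p p' -
      (√(2 * Real.pi * (m * (p * (1 - p)) + m' * (p' * (1 - p')))))⁻¹ *
        Real.exp (-((m * p - m' * p') ^ 2 / (2 * (m * (p * (1 - p)) + m' * (p' * (1 - p'))))))| ≤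
      C / (m * (p * (1 - p)) + m' * (p' * (1 - p'))) := by
  set K := 20 * (Real.exp Real.pi + 1) + 1 with hK
  have hK0 : 0 < K := by positivity
  refine ⟨10 * K, by positivity, fun m m' p p' h0 h1 h0' h1' hV => ?_⟩
  set V := m * (p * (1 - p)) + m' * (p' * (1 - p')) with hVdef
  set μ := m * p - m' * p' with hμ
  have hpi := Real.pi_pos
  set φ : ℝ → ℂ := fun θ => bernoulliChar p θ ^ m * bernoulliChar p' (-θ) ^ m' with hφ
  set γ : ℝ → ℂ := fun θ => bernoulliGauss p θ ^ m * bernoulliGauss p' (-θ) ^ m' with hγ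
  have hφc : Continuous φ := by
    simp only [hφ, bernoulliChar]; fun_prop
  have hγe : ∀ θ, γ θ = Complex.exp ((-(V / 2 : ℝ) : ℂ) * (θ : ℂ) ^ 2 +
      (μ * Complex.I) * (θ : ℂ) + 0) := by
    intro θ
    simp only [hγ, bernoulliGauss]
    rw [← Complex.exp_nat_mul, ← Complex.exp_nat_mul, ← Complex.exp_add, hVdef, hμ]
    congr 1
    push_cast; ring
  have hre : (-(V / 2 : ℝ) : ℂ).re < 0 := by
    rw [← Complex.ofReal_neg, Complex.ofReal_re]; linarith
  have hγi : Integrable γ := by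
    refine (integrable_cexp_quadratic' hre (μ * Complex.I) 0).congr (ae_of_all _ fun θ => ?_)
    exact (hγe θ).symm
  have hγint : ∫ θ, γ θ = ((2 * Real.pi * ((√(2 * Real.pi * V))⁻¹ *
      Real.exp (-(μ ^ 2 / (2 * V)))) : ℝ) : ℂ) := by
    simp_rw [hγe]
    rw [integral_cexp_quadratic hre]
    have a1 : ((Real.pi : ℂ) / - -((V / 2 : ℝ) : ℂ)) ^ (1 / 2 : ℂ) =
        ((2 * Real.pi * (√(2 * Real.pi * V))⁻¹ : ℝ) : ℂ) := by
      have : ((Real.pi : ℂ) / - -((V / 2 : ℝ) : ℂ)) = ((Real.pi / (V / 2) : ℝ) : ℂ) := by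
        push_cast; ring
      rw [this, show (1 / 2 : ℂ) = ((1 / 2 : ℝ) : ℂ) by push_cast; ring,
        ← Complex.ofReal_cpow (by positivity), ← Real.sqrt_eq_rpow]
      congr 1
      have : Real.pi / (V / 2) = (2 * Real.pi * (√(2 * Real.pi * V))⁻¹) ^ 2 := by
        rw [mul_pow, inv_pow, Real.sq_sqrt (by positivity)]; field_simp
      rw [this, Real.sqrt_sq (by positivity)]
    have a2 : (0 : ℂ) - ((μ : ℂ) * Complex.I) ^ 2 / (4 * -((V / 2 : ℝ) : ℂ)) =
        ((-(μ ^ 2 / (2 * V)) : ℝ) : ℂ) := by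
      rw [mul_pow, Complex.I_sq]; push_cast
      have : (V : ℂ) ≠ 0 := by exact_mod_cast hV.ne'
      field_simp
      ring
    rw [a1, a2, ← Complex.ofReal_exp]
    push_cast; ring
  have hP : (2 * Real.pi : ℂ) * (binomialCoincidence m m' p p' : ℂ) =
      ∫ θ, (Set.Ioc (-Real.pi) Real.pi).indicator φ θ := by
    rw [integral_indicator measurableSet_Ioc,
      ← intervalIntegral.integral_of_le (by linarith), integral_bernoulliChar,
      binomialCoincidence_eq_sum, Set.projIcc_of_mem zero_le_one ⟨h0, h1⟩,
      Set.projIcc_of_mem zero_le_one ⟨h0', h1'⟩]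
  have hφi : Integrable ((Set.Ioc (-Real.pi) Real.pi).indicator φ) := by
    rw [integrable_indicator_iff measurableSet_Ioc]
    exact (hφc.integrableOn_Icc).mono_set Set.Ioc_subset_Icc_self
  have hbound : ∀ θ, ‖(Set.Ioc (-Real.pi) Real.pi).indicator φ θ - γ θ‖ ≤
      K * (|θ| * Real.exp (-(V / 10 * θ ^ 2))) := by
    intro θ
    have hnn : 0 ≤ |θ| * Real.exp (-(V / 10 * θ ^ 2)) := by positivity
    by_cases hθ : θ ∈ Set.Ioc (-Real.pi) Real.pi
    · rw [Set.indicator_of_mem hθ]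
      refine (norm_char_sub_gauss_le h0 h1 h0' h1' m m' (abs_le.2 ⟨hθ.1.le, hθ.2⟩)).trans ?_
      gcongr
      rw [hK]; linarith
    -- The Gaussian is integrated over the whole line so that its integral is explicit. Its tail
    -- beyond `π` obeys the same bound because `|θ| ≥ 1` there; the summand `+ 1` in `K` gives `K ≥
    -- 1`.
    · rw [Set.indicator_of_notMem hθ, zero_sub, norm_neg, hγe, Complex.norm_exp]
      have e : ((-(V / 2 : ℝ) : ℂ) * (θ : ℂ) ^ 2 + (μ * Complex.I) * (θ : ℂ) + 0) =
          ((-(V / 2 * θ ^ 2) : ℝ) : ℂ) + ((μ * θ : ℝ) : ℂ) * Complex.I := by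
        push_cast; ring
      rw [e, Complex.add_re, Complex.ofReal_re, Complex.re_ofReal_mul, Complex.I_re, mul_zero,
        add_zero]
      have h1θ : 1 ≤ |θ| := by
        by_contra! hc
        rw [abs_lt] at hc
        apply hθ
        constructor <;> linarith [Real.pi_gt_three]
      have h1K : 1 ≤ K := by
        rw [hK]; linarith [Real.exp_pos Real.pi]
      calc Real.exp (-(V / 2 * θ ^ 2)) ≤ Real.exp (-(V / 10 * θ ^ 2)) := by
            apply Real.exp_le_exp.2; nlinarith [mul_nonneg hV.le (sq_nonneg θ)]
        _ ≤ K * (|θ| * Real.exp (-(V / 10 * θ ^ 2))) := by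
            rw [← mul_assoc]
            refine le_mul_of_one_le_left (Real.exp_pos _).le ?_
            nlinarith
  have hfin : ‖(2 * Real.pi : ℂ) * (binomialCoincidence m m' p p' : ℂ) -
      ((2 * Real.pi * ((√(2 * Real.pi * V))⁻¹ * Real.exp (-(μ ^ 2 / (2 * V)))) : ℝ) : ℂ)‖ ≤
      K * (10 / V) := by
    rw [hP, ← hγint, ← integral_sub hφi hγi]
    refine (norm_integral_le_of_norm_le
      ((integrable_abs_mul_exp_neg_mul_sq (by positivity : 0 < V / 10)).const_mul K)
      (ae_of_all _ hbound)).trans ?_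
    rw [integral_const_mul, integral_abs_mul_exp_neg_mul_sq (by positivity)]
    apply le_of_eq; field_simp
  have e : (2 * Real.pi : ℂ) * (binomialCoincidence m m' p p' : ℂ) -
      ((2 * Real.pi * ((√(2 * Real.pi * V))⁻¹ * Real.exp (-(μ ^ 2 / (2 * V)))) : ℝ) : ℂ) =
      ((2 * Real.pi * (binomialCoincidence m m' p p' -
        (√(2 * Real.pi * V))⁻¹ * Real.exp (-(μ ^ 2 / (2 * V)))) : ℝ) : ℂ) := by
    push_cast; ring
  rw [e, Complex.norm_real, Real.norm_eq_abs, abs_mul, abs_of_pos (by positivity)] at hfin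
  refine le_trans ?_ (hfin.trans (le_of_eq (by ring)))
  refine le_mul_of_one_le_left (abs_nonneg _) ?_
  linarith [Real.pi_gt_three]

/-! ### Gaussian approximation of the binomial kernel. -/

/-- `2 - r/s - r/t`, the limiting variance per unit of `r`. -/
noncomputable def varRate (s t r : ℝ) : ℝ := 2 - r / s - r / t

/-- The limit of the binomial kernel. -/
noncomputable def limitKernel (x y : Plane) (r s t : ℝ) : ℝ :=
  (2 * Real.pi * (r * varRate s t r))⁻¹ *
    Real.exp (-(r / varRate s t r * (‖x - y‖ ^ 2 / 2)))

lemma eventually_inv_sqrt_le {c : ℝ} (hc : 0 < c) : ∀ᶠ N : ℕ in atTop, (√(N : ℝ))⁻¹ ≤ c := by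
  have h : Tendsto (fun N : ℕ => (√(N : ℝ))⁻¹) atTop (𝓝 0) :=
    (Real.tendsto_sqrt_atTop.comp tendsto_natCast_atTop_atTop).inv_tendsto_atTop
  exact (h.eventually (gt_mem_nhds hc)).mono fun N hN => hN.le

/-- Here `f` is the fractional part lost by the floor; the condition on `a` keeps the floor's
argument nonnegative, so the natural-number floor does not truncate. -/
lemma exists_trials_eq {a u : ℝ} (hu : 0 < u) {N : ℕ} (hN : 0 < N)
    (ha : |a| * (√(N : ℝ))⁻¹ ≤ 1) : ∃ f : ℝ, 0 ≤ f ∧ f ≤ 1 ∧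
      (trials N a u : ℝ) = N * u * (1 + a * (√(N : ℝ))⁻¹ - f / u * (√(N : ℝ))⁻¹ ^ 2) := by
  have hN' : (0 : ℝ) < N := by exact_mod_cast hN
  set X := (N : ℝ) * u + (N : ℝ) * u * (a / √(N : ℝ)) with hX
  have hX' : X = N * u * (1 + a * (√(N : ℝ))⁻¹) := by rw [hX]; ring
  have hX0 : 0 ≤ X := by
    rw [hX']
    have : -(1 : ℝ) ≤ a * (√(N : ℝ))⁻¹ := by
      have := neg_abs_le (a * (√(N : ℝ))⁻¹)
      rw [abs_mul, abs_of_nonneg (by positivity : 0 ≤ (√(N : ℝ))⁻¹)] at this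
      linarith
    have h2 : 0 ≤ 1 + a * (√(N : ℝ))⁻¹ := by linarith
    positivity
  refine ⟨X - ⌊X⌋₊, by linarith [Nat.floor_le hX0], by linarith [Nat.lt_floor_add_one X], ?_⟩
  have hsq : (√(N : ℝ))⁻¹ ^ 2 = (N : ℝ)⁻¹ := by rw [inv_pow, Real.sq_sqrt hN'.le]
  have : (trials N a u : ℝ) = X - (X - ⌊X⌋₊) := by rw [trials]; ring
  rw [this, hsq]
  nth_rewrite 1 [hX']
  field_simp

/-- Numbers of trials, relative to their leading order. -/
lemma exists_trials_ratio (a b : ℝ) {s t : ℝ} (hs : 0 < s) (ht : 0 < t) :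
    ∃ C : ℝ, 0 < C ∧ ∀ᶠ N : ℕ in atTop, ∃ α β : ℝ,
      (trials N a s : ℝ) = N * s * α ∧ (trials N b t : ℝ) = N * t * β ∧
      |α - 1| ≤ C * (√(N : ℝ))⁻¹ ∧ |β - 1| ≤ C * (√(N : ℝ))⁻¹ ∧
      |√(N : ℝ) * (α - β) - (a - b)| ≤ C * (√(N : ℝ))⁻¹ := by
  refine ⟨|a| + |b| + 1 / s + 1 / t, by positivity, ?_⟩
  filter_upwards [eventually_gt_atTop 0, eventually_inv_sqrt_le one_pos,
    eventually_inv_sqrt_le (by positivity : 0 < (|a| + 1)⁻¹),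
    eventually_inv_sqrt_le (by positivity : 0 < (|b| + 1)⁻¹)] with N hN h1 ha hb
  have hN' : (0 : ℝ) < N := by exact_mod_cast hN
  set ε := (√(N : ℝ))⁻¹ with hε
  have hε0 : 0 < ε := by positivity
  have ha' : |a| * ε ≤ 1 := by
    calc |a| * ε ≤ (|a| + 1) * (|a| + 1)⁻¹ := by gcongr; linarith
      _ = 1 := mul_inv_cancel₀ (by positivity)
  have hb' : |b| * ε ≤ 1 := by
    calc |b| * ε ≤ (|b| + 1) * (|b| + 1)⁻¹ := by gcongr; linarith
      _ = 1 := mul_inv_cancel₀ (by positivity)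
  obtain ⟨f, f0, f1, hf⟩ := exists_trials_eq hs hN ha'
  obtain ⟨g, g0, g1, hg⟩ := exists_trials_eq ht hN hb'
  have hfs : f / s * ε ^ 2 ≤ 1 / s * ε := by
    have : f / s ≤ 1 / s := by gcongr
    have h2 : ε ^ 2 ≤ ε := by nlinarith
    gcongr
  have hgt : g / t * ε ^ 2 ≤ 1 / t * ε := by
    have : g / t ≤ 1 / t := by gcongr
    have h2 : ε ^ 2 ≤ ε := by nlinarith
    gcongr
  have hfs0 : 0 ≤ f / s * ε ^ 2 := by positivity
  have hgt0 : 0 ≤ g / t * ε ^ 2 := by positivity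
  have hsi : 0 ≤ 1 / s * ε := by positivity
  have hti : 0 ≤ 1 / t * ε := by positivity
  have haa : 0 ≤ |a| * ε := by positivity
  have hbb : 0 ≤ |b| * ε := by positivity
  have hae := abs_le.1 (le_of_eq (by rw [abs_mul, abs_of_pos hε0] : |a * ε| = |a| * ε))
  have hbe := abs_le.1 (le_of_eq (by rw [abs_mul, abs_of_pos hε0] : |b * ε| = |b| * ε))
  have hse : √(N : ℝ) * ε = 1 := mul_inv_cancel₀ (by positivity)
  have e : √(N : ℝ) * ((1 + a * ε - f / s * ε ^ 2) - (1 + b * ε - g / t * ε ^ 2)) - (a - b) =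
      g / t * ε - f / s * ε := by
    linear_combination (a - b - f / s * ε + g / t * ε) * hse
  have hf1 : f / s * ε ≤ 1 / s * ε := by gcongr
  have hg1 : g / t * ε ≤ 1 / t * ε := by gcongr
  have hf2 : 0 ≤ f / s * ε := by positivity
  have hg2 : 0 ≤ g / t * ε := by positivity
  refine ⟨_, _, hf, hg, ?_, ?_, ?_⟩
  · rw [abs_le]; constructor <;> linarith
  · rw [abs_le]; constructor <;> linarith
  · rw [e, abs_le]; constructor <;> linarith

set_option maxHeartbeats 1000000 in
/-- Gaussian approximation of the kernel in one coordinate. -/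
lemma exists_binomialKernelCoord_approx (a b : ℝ) {s t : ℝ} (hs : 0 < s) (hst : s ≤ t) :
    ∃ C : ℝ, 0 < C ∧ ∀ᶠ N : ℕ in atTop, ∀ r : ℝ, 0 < r → r ≤ s → 0 < varRate s t r →
      ∃ m v : ℝ, |v - 1| ≤ C * (√(N : ℝ))⁻¹ ∧ 1 / 2 ≤ v ∧ v ≤ 3 / 2 ∧
        |m ^ 2 / (2 * v) - (a - b) ^ 2 / 2| ≤ C * (√(N : ℝ))⁻¹ ∧
        |binomialKernelCoord N a b r s t - (√(2 * Real.pi * (r * varRate s t r * v)))⁻¹ *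
          Real.exp (-(r / varRate s t r * (m ^ 2 / (2 * v))))| ≤
            C * (√(N : ℝ))⁻¹ / (r * varRate s t r) := by
  have ht : 0 < t := hs.trans_le hst
  obtain ⟨C₀, hC₀, hclt⟩ := exists_binomialCoincidence_sub_gauss_le
  obtain ⟨C₁, hC₁, hr⟩ := exists_trials_ratio a b hs ht
  set Δ := a - b with hΔ
  set C₂ := C₁ * (2 * |Δ| + C₁) + Δ ^ 2 * C₁ with hC₂
  have hC₂0 : 0 < C₂ := by positivity
  refine ⟨C₁ + C₂ + 2 * C₀, by positivity, ?_⟩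
  filter_upwards [hr, eventually_gt_atTop 0, eventually_inv_sqrt_le one_pos,
    eventually_inv_sqrt_le (by positivity : 0 < (2 * C₁)⁻¹)] with N hN hN0 h1 h2 r hr0 hrs hσ
  obtain ⟨α, β, hα, hβ, hα1, hβ1, hαβ⟩ := hN
  have hN' : (0 : ℝ) < N := by exact_mod_cast hN0
  set ε := (√(N : ℝ))⁻¹ with hε
  have hε0 : 0 < ε := by positivity
  have hhalf : C₁ * ε ≤ 1 / 2 := by
    calc C₁ * ε ≤ C₁ * (2 * C₁)⁻¹ := by gcongr
      _ = 1 / 2 := by field_simp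
  set σ := varRate s t r with hσd
  set q := r * σ with hq
  have hq0 : 0 < q := by positivity
  have hrs1 : r / s ≤ 1 := by rw [div_le_one hs]; exact hrs
  have hrt1 : r / t ≤ 1 := by rw [div_le_one ht]; exact hrs.trans hst
  have hσe : σ = (1 - r / s) + (1 - r / t) := by rw [hσd, varRate]; ring
  -- A weighted mean of `α` and `β` with weights summing to `1`: it stays close to `1` uniformly in
  -- `r`, even where `σ` is small.
  set v := (α * (1 - r / s) + β * (1 - r / t)) / σ with hv
  set m := √(N : ℝ) * (α - β) with hm
  have hv1 : |v - 1| ≤ C₁ * ε := by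
    have : v - 1 = ((α - 1) * (1 - r / s) + (β - 1) * (1 - r / t)) / σ := by
      rw [hv, eq_div_iff hσ.ne', sub_mul, div_mul_cancel₀ _ hσ.ne', one_mul, hσe]; ring
    rw [this, abs_div, abs_of_pos hσ, div_le_iff₀ hσ]
    refine (abs_add_le _ _).trans ?_
    rw [abs_mul, abs_mul, abs_of_nonneg (by linarith : 0 ≤ 1 - r / s),
      abs_of_nonneg (by linarith : 0 ≤ 1 - r / t)]
    calc _ ≤ C₁ * ε * (1 - r / s) + C₁ * ε * (1 - r / t) := by
          gcongr
      _ = _ := by rw [hσe]; ring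
  obtain ⟨hva, hvb⟩ := abs_le.1 (hv1.trans hhalf)
  have hv0 : 0 < v := by linarith
  have hmono : ∀ c : ℝ, 0 ≤ c → c ≤ C₁ + C₂ + 2 * C₀ → c * ε ≤ (C₁ + C₂ + 2 * C₀) * ε :=
    fun c _ hc => mul_le_mul_of_nonneg_right hc hε0.le
  refine ⟨m, v, hv1.trans (hmono _ hC₁.le (by linarith)), by linarith, by linarith, ?_, ?_⟩
  · refine le_trans ?_ (hmono C₂ hC₂0.le (by linarith))
    have e : m ^ 2 / (2 * v) - Δ ^ 2 / 2 = ((m - Δ) * (m + Δ) + Δ ^ 2 * (1 - v)) / (2 * v) := by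
      field_simp; ring
    have hms : |m + Δ| ≤ 2 * |Δ| + C₁ := by
      have : m + Δ = (m - Δ) + 2 * Δ := by ring
      rw [this]
      refine (abs_add_le _ _).trans ?_
      rw [abs_mul, abs_two]
      nlinarith
    rw [e, abs_div, abs_of_pos (by positivity : 0 < 2 * v)]
    refine (div_le_self (abs_nonneg _) (by linarith)).trans ?_
    refine (abs_add_le _ _).trans ?_
    rw [abs_mul, abs_mul, abs_of_nonneg (sq_nonneg Δ), abs_sub_comm 1 v]
    calc _ ≤ C₁ * ε * (2 * |Δ| + C₁) + Δ ^ 2 * (C₁ * ε) := by gcongr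
      _ = C₂ * ε := by rw [hC₂]; ring
  -- The variance is exactly `N q v` and the difference of the means is `√N r m`, so the Gaussian
  -- exponent is `r / σ` times `m² / (2 v)`: the possibly unbounded factor is separated from the
  -- converging one.
  · have hV : (trials N a s : ℝ) * (r / s * (1 - r / s)) +
        (trials N b t : ℝ) * (r / t * (1 - r / t)) = N * (q * v) := by
      rw [hα, hβ, hq, hv]; field_simp
    have hμ : (trials N a s : ℝ) * (r / s) - (trials N b t : ℝ) * (r / t) = √(N : ℝ) * (r * m) := by
      rw [hα, hβ, hm]
      have : √(N : ℝ) * √(N : ℝ) = N := Real.mul_self_sqrt hN'.le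
      field_simp
      linear_combination (-(α - β)) * this
    have h := hclt (trials N a s) (trials N b t) (r / s) (r / t) (by positivity) hrs1
      (by positivity) hrt1 (by rw [hV]; positivity)
    rw [hV, hμ] at h
    have e1 : √(N : ℝ) * ((√(2 * Real.pi * (N * (q * v))))⁻¹ *
        Real.exp (-((√(N : ℝ) * (r * m)) ^ 2 / (2 * (N * (q * v)))))) =
        (√(2 * Real.pi * (q * v)))⁻¹ * Real.exp (-(r / σ * (m ^ 2 / (2 * v)))) := by
      have i1 : √(2 * Real.pi * (N * (q * v))) = √(N : ℝ) * √(2 * Real.pi * (q * v)) := by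
        rw [← Real.sqrt_mul hN'.le]; congr 1; ring
      have i2 : (√(N : ℝ) * (r * m)) ^ 2 / (2 * (N * (q * v))) = r / σ * (m ^ 2 / (2 * v)) := by
        rw [mul_pow, Real.sq_sqrt hN'.le, hq]; field_simp
      rw [i1, i2, ← mul_assoc]
      congr 1
      have : 0 < √(N : ℝ) := by positivity
      field_simp
    have e2 : √(N : ℝ) * (C₀ / (N * (q * v))) = C₀ * ε / (q * v) := by
      rw [hε]
      have : √(N : ℝ) * √(N : ℝ) = N := Real.mul_self_sqrt hN'.le
      field_simp
      rw [sq]; linarith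
    rw [binomialKernelCoord, ← e1, ← mul_sub, abs_mul, abs_of_nonneg (Real.sqrt_nonneg _)]
    refine (mul_le_mul_of_nonneg_left h (Real.sqrt_nonneg _)).trans ?_
    rw [e2, div_le_div_iff₀ (by positivity) hq0]
    have hcv : 2 * C₀ * (1 / 2) ≤ (C₁ + C₂ + 2 * C₀) * v :=
      mul_le_mul (by linarith) (by linarith) (by norm_num) (by linarith)
    calc C₀ * ε * q = 2 * C₀ * (1 / 2) * (ε * q) := by ring
      _ ≤ (C₁ + C₂ + 2 * C₀) * v * (ε * q) := mul_le_mul_of_nonneg_right hcv (by positivity)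
      _ = _ := by ring

/-- The factor `exp (-c)` is retained because it later compensates the unbounded factor `r / varRate
s t r` in the exponents. -/
lemma abs_exp_neg_sub_exp_neg_le {a b c : ℝ} (ha : c ≤ a) (hb : c ≤ b) :
    |Real.exp (-a) - Real.exp (-b)| ≤ |a - b| * Real.exp (-c) := by
  wlog hab : a ≤ b generalizing a b
  · rw [abs_sub_comm, abs_sub_comm a]
    exact this hb ha (by linarith)
  have h1 : Real.exp (-b) = Real.exp (-a) * Real.exp (a - b) := by
    rw [← Real.exp_add]; congr 1; ring
  have h2 := Real.add_one_le_exp (a - b)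
  have h3 : Real.exp (a - b) ≤ 1 := by rw [Real.exp_le_one_iff]; linarith
  have h4 : Real.exp (-a) ≤ Real.exp (-c) := Real.exp_le_exp.2 (by linarith)
  have h5 := Real.exp_pos (-a)
  rw [h1, abs_of_nonneg (by nlinarith), abs_of_nonpos (by linarith)]
  calc Real.exp (-a) - Real.exp (-a) * Real.exp (a - b) =
        Real.exp (-a) * (1 - Real.exp (a - b)) := by ring
    _ ≤ Real.exp (-c) * (-(a - b)) := by
        apply mul_le_mul h4 <;> linarith
    _ = _ := by ring

set_option maxHeartbeats 1000000 in
/-- Comparison of a product of two approximate Gaussian densities with the limiting product. -/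
lemma abs_mul_sub_gauss_le {b₁ b₂ q v₁ v₂ k₁ k₂ κ z ε A Q Z C : ℝ} (hq : 0 < q) (hqQ : q ≤ Q)
    (hC : 0 ≤ C) (hε : 0 ≤ ε) (hεA : ε ≤ A * √q) (hz : 0 ≤ z)
    (hv₁ : |v₁ - 1| ≤ C * ε) (hv₁' : 1 / 2 ≤ v₁) (hv₂ : |v₂ - 1| ≤ C * ε) (hv₂' : 1 / 2 ≤ v₂)
    (hv₂'' : v₂ ≤ 3 / 2) (hk₁ : 0 ≤ k₁) (hk₂ : 0 ≤ k₂)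
    (hk : |k₁ + k₂ - κ| ≤ 2 * (C * ε)) (hκ : κ / 2 ≤ k₁ + k₂) (hκ0 : 0 ≤ κ)
    (hZ : z * Real.exp (-(z * (κ / 2))) ≤ Z)
    (h₁ : |b₁ - (√(2 * Real.pi * (q * v₁)))⁻¹ * Real.exp (-(z * k₁))| ≤ C * ε / q)
    (h₂ : |b₂ - (√(2 * Real.pi * (q * v₂)))⁻¹ * Real.exp (-(z * k₂))| ≤ C * ε / q) :
    |b₁ * b₂ - (2 * Real.pi * q)⁻¹ * Real.exp (-(z * κ))| ≤
      (C * (2 + C * A) + √Q * (5 * C + 2 * C * Z)) * ε / (q * √q) := by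
  have hpi := Real.pi_gt_three
  have hw : 0 < √q := by positivity
  have hww : √q * √q = q := Real.mul_self_sqrt hq.le
  have hbnd : ∀ v k : ℝ, 1 / 2 ≤ v → 0 ≤ k →
      |(√(2 * Real.pi * (q * v)))⁻¹ * Real.exp (-(z * k))| ≤ 1 / √q := by
    intro v k hv hk
    rw [abs_of_nonneg (by positivity), one_div]
    refine (mul_le_of_le_one_right (by positivity) ?_).trans ?_
    · rw [Real.exp_le_one_iff]; nlinarith [mul_nonneg hz hk]
    · gcongr
      nlinarith [mul_pos hq (by linarith : 0 < v)]
  set a₁ := (√(2 * Real.pi * (q * v₁)))⁻¹ * Real.exp (-(z * k₁)) with ha₁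
  set a₂ := (√(2 * Real.pi * (q * v₂)))⁻¹ * Real.exp (-(z * k₂)) with ha₂
  have ha₁' : |a₁| ≤ 1 / √q := hbnd v₁ k₁ hv₁' hk₁
  have ha₂' : |a₂| ≤ 1 / √q := hbnd v₂ k₂ hv₂' hk₂
  -- The condition `ε ≤ A √q` makes the error of one factor no larger in order than the factor
  -- itself, which is needed to bound `b₂`.
  have hεq : C * ε / q ≤ C * A / √q := by
    rw [div_le_div_iff₀ hq hw]
    nth_rewrite 2 [← hww]
    calc C * ε * √q ≤ C * (A * √q) * √q := by gcongr
      _ = _ := by ring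
  have hb₂ : |b₂| ≤ (1 + C * A) / √q := by
    have : b₂ = (b₂ - a₂) + a₂ := by ring
    rw [this]
    refine (abs_add_le _ _).trans ?_
    rw [add_div]; linarith
  have hP1 : |b₁ * b₂ - a₁ * a₂| ≤ C * (2 + C * A) * ε / (q * √q) := by
    have : b₁ * b₂ - a₁ * a₂ = (b₁ - a₁) * b₂ + a₁ * (b₂ - a₂) := by ring
    rw [this]
    refine (abs_add_le _ _).trans ?_
    rw [abs_mul, abs_mul]
    calc _ ≤ C * ε / q * ((1 + C * A) / √q) + 1 / √q * (C * ε / q) := by gcongr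
      _ = _ := by field_simp; ring
  set u := √(v₁ * v₂) with hu
  have hv₁0 : 0 < v₁ := by linarith
  have hv₂0 : 0 < v₂ := by linarith
  have hu0 : 0 < u := by positivity
  have hu2 : u * u = v₁ * v₂ := Real.mul_self_sqrt (by positivity)
  have hu1 : 1 / 2 ≤ u := by nlinarith
  have hvv : |v₁ * v₂ - 1| ≤ 5 / 2 * (C * ε) := by
    have : v₁ * v₂ - 1 = (v₁ - 1) * v₂ + (v₂ - 1) := by ring
    rw [this]
    refine (abs_add_le _ _).trans ?_
    rw [abs_mul, abs_of_pos hv₂0]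
    have : |v₁ - 1| * v₂ ≤ C * ε * (3 / 2) := by gcongr
    linarith
  have huinv : |u⁻¹ - 1| ≤ 5 * C * ε := by
    have e : u⁻¹ - 1 = (1 - v₁ * v₂) / (u * (1 + u)) := by
      rw [← hu2]; field_simp; ring
    rw [e, abs_div, abs_of_pos (by positivity : 0 < u * (1 + u)), div_le_iff₀ (by positivity),
      abs_sub_comm]
    have h0 : 0 ≤ 5 * (C * ε) := by positivity
    have : 5 * (C * ε) * (1 / 2) ≤ 5 * (C * ε) * (u * (1 + u)) :=
      mul_le_mul_of_nonneg_left (by nlinarith) h0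
    linarith
  have haa : a₁ * a₂ = (2 * Real.pi * q)⁻¹ * (u⁻¹ * Real.exp (-(z * (k₁ + k₂)))) := by
    have e1 : Real.exp (-(z * (k₁ + k₂))) = Real.exp (-(z * k₁)) * Real.exp (-(z * k₂)) := by
      rw [← Real.exp_add]; congr 1; ring
    have e2 : √(2 * Real.pi * (q * v₁)) * √(2 * Real.pi * (q * v₂)) = 2 * Real.pi * q * u := by
      rw [← Real.sqrt_mul (by positivity), hu]
      have : 2 * Real.pi * (q * v₁) * (2 * Real.pi * (q * v₂)) =
        (2 * Real.pi * q) ^ 2 * (v₁ * v₂) := by ring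
      rw [this, Real.sqrt_mul (by positivity), Real.sqrt_sq (by positivity)]
    rw [ha₁, ha₂, mul_mul_mul_comm, ← mul_inv, e2, e1, mul_inv]; ring
  have hexp : |Real.exp (-(z * (k₁ + k₂))) - Real.exp (-(z * κ))| ≤ 2 * C * Z * ε := by
    refine (abs_exp_neg_sub_exp_neg_le (c := z * (κ / 2)) (by gcongr) (by gcongr; linarith)).trans ?_
    rw [← mul_sub, abs_mul, abs_of_nonneg hz]
    calc z * |k₁ + k₂ - κ| * Real.exp (-(z * (κ / 2)))
        = |k₁ + k₂ - κ| * (z * Real.exp (-(z * (κ / 2)))) := by ring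
      _ ≤ 2 * (C * ε) * Z := by gcongr
      _ = _ := by ring
  have hP2 : |a₁ * a₂ - (2 * Real.pi * q)⁻¹ * Real.exp (-(z * κ))| ≤
      √Q * (5 * C + 2 * C * Z) * ε / (q * √q) := by
    rw [haa, ← mul_sub, abs_mul, abs_of_pos (by positivity : 0 < (2 * Real.pi * q)⁻¹)]
    have e : u⁻¹ * Real.exp (-(z * (k₁ + k₂))) - Real.exp (-(z * κ)) =
        (u⁻¹ - 1) * Real.exp (-(z * (k₁ + k₂))) +
          (Real.exp (-(z * (k₁ + k₂))) - Real.exp (-(z * κ))) := by ring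
    have h1 : |u⁻¹ * Real.exp (-(z * (k₁ + k₂))) - Real.exp (-(z * κ))| ≤
        (5 * C + 2 * C * Z) * ε := by
      rw [e]
      refine (abs_add_le _ _).trans ?_
      rw [abs_mul, abs_of_pos (Real.exp_pos _)]
      have : Real.exp (-(z * (k₁ + k₂))) ≤ 1 := by
        rw [Real.exp_le_one_iff]; nlinarith [mul_nonneg hz hk₁, mul_nonneg hz hk₂]
      have : |u⁻¹ - 1| * Real.exp (-(z * (k₁ + k₂))) ≤ |u⁻¹ - 1| :=
        mul_le_of_le_one_right (abs_nonneg _) this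
      linarith
    have h0 : 0 ≤ (5 * C + 2 * C * Z) * ε := (abs_nonneg _).trans h1
    -- This part of the error is only of order `ε / q`; the bound `q ≤ Q` brings it to the common
    -- form `ε / (q √q)`.
    have h2 : (2 * Real.pi * q)⁻¹ ≤ √Q / (q * √q) := by
      rw [inv_eq_one_div, div_le_div_iff₀ (by positivity) (by positivity)]
      have : √q ≤ √Q := Real.sqrt_le_sqrt hqQ
      have hQ0 : 0 ≤ √Q := Real.sqrt_nonneg _
      have hQq : 0 ≤ √Q * q := mul_nonneg hQ0 hq.le
      calc 1 * (q * √q) = q * √q := one_mul _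
        _ ≤ q * √Q := mul_le_mul_of_nonneg_left this hq.le
        _ = √Q * q * 1 := by ring
        _ ≤ √Q * q * (2 * Real.pi) := mul_le_mul_of_nonneg_left (by linarith) hQq
        _ = √Q * (2 * Real.pi * q) := by ring
    calc _ ≤ √Q / (q * √q) * ((5 * C + 2 * C * Z) * ε) := by gcongr
      _ = _ := by ring
  have : b₁ * b₂ - (2 * Real.pi * q)⁻¹ * Real.exp (-(z * κ)) = (b₁ * b₂ - a₁ * a₂) +
      (a₁ * a₂ - (2 * Real.pi * q)⁻¹ * Real.exp (-(z * κ))) := by ring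
  rw [this]
  refine (abs_add_le _ _).trans ((add_le_add hP1 hP2).trans (le_of_eq ?_))
  rw [← add_div, ← add_mul]

/-- The binomial kernel is close to its limit wherever the variance is not too small. -/
lemma exists_binomialKernel_approx {s t : ℝ} {x y : Plane} (hs : 0 < s) (hst : s ≤ t)
    (hxy : s < t ∨ x ≠ y) {A : ℝ} (hA : 0 ≤ A) :
    ∃ C : ℝ, 0 < C ∧ ∀ᶠ N : ℕ in atTop, ∀ r : ℝ, 0 < r → r ≤ s → 0 < varRate s t r →
      (√(N : ℝ))⁻¹ ≤ A * √(r * varRate s t r) →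
      |binomialKernel N x y r s t - limitKernel x y r s t| ≤
        C * (√(N : ℝ))⁻¹ / (r * varRate s t r * √(r * varRate s t r)) := by
  have ht : 0 < t := hs.trans_le hst
  obtain ⟨C₁, hC₁, H₁⟩ := exists_binomialKernelCoord_approx (x 0) (y 0) hs hst
  obtain ⟨C₂, hC₂, H₂⟩ := exists_binomialKernelCoord_approx (x 1) (y 1) hs hst
  set κ := ‖x - y‖ ^ 2 / 2 with hκ
  have hκ0 : 0 ≤ κ := by positivity
  have hκe : κ = (x 0 - y 0) ^ 2 / 2 + (x 1 - y 1) ^ 2 / 2 := by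
    rw [hκ, EuclideanSpace.norm_sq_eq]
    simp [Fin.sum_univ_two]; ring
  -- The ratio `r / varRate s t r` is bounded if `s < t`; if `x ≠ y` it may blow up, but the
  -- exponential then dominates it.
  obtain ⟨Z, hZ0, hZ⟩ : ∃ Z : ℝ, 0 ≤ Z ∧ ∀ r : ℝ, 0 < r → r ≤ s → 0 < varRate s t r →
      r / varRate s t r * Real.exp (-(r / varRate s t r * (κ / 2))) ≤ Z := by
    rcases hxy with hlt | hne
    · have hst1 : 0 < 1 - s / t := by rw [sub_pos, div_lt_one ht]; exact hlt
      refine ⟨s / (1 - s / t), by positivity, fun r hr hrs hσ => ?_⟩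
      have : 1 - s / t ≤ varRate s t r := by
        have h1 : r / s ≤ 1 := by rw [div_le_one hs]; exact hrs
        have h2 : r / t ≤ s / t := by gcongr
        rw [varRate]; linarith
      refine (mul_le_of_le_one_right (by positivity) ?_).trans (by gcongr)
      rw [Real.exp_le_one_iff, neg_nonpos]; positivity
    · have hκp : 0 < κ := by
        have : 0 < ‖x - y‖ := norm_pos_iff.2 (sub_ne_zero.2 hne)
        positivity
      refine ⟨2 / κ, by positivity, fun r hr hrs hσ => ?_⟩
      set z := r / varRate s t r
      have hz : 0 < z := by positivity
      have h := Real.add_one_le_exp (z * (κ / 2))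
      rw [Real.exp_neg, ← div_eq_mul_inv, div_le_div_iff₀ (Real.exp_pos _) hκp]
      linarith
  set C := C₁ + C₂ with hC
  have hC0 : 0 < C := by positivity
  refine ⟨C * (2 + C * A) + √(2 * s) * (5 * C + 2 * C * Z), by positivity, ?_⟩
  -- This secures `κ / 2 ≤ k₁ + k₂`: for `κ > 0` when `N` is large, for `κ = 0` trivially.
  have hκev : ∀ᶠ N : ℕ in atTop, 2 * (C * (√(N : ℝ))⁻¹) ≤ κ / 2 ∨ κ = 0 := by
    rcases hκ0.eq_or_lt with h | h
    · exact Eventually.of_forall fun N => Or.inr h.symm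
    · filter_upwards [eventually_inv_sqrt_le (by positivity : 0 < κ / (4 * C))] with N hN
      left
      calc 2 * (C * (√(N : ℝ))⁻¹) ≤ 2 * (C * (κ / (4 * C))) := by gcongr
        _ = κ / 2 := by field_simp; norm_num
  filter_upwards [H₁, H₂, hκev] with N h₁ h₂ h₃ r hr hrs hσ hεA
  obtain ⟨m₁, v₁, a1, a2, a3, a4, a5⟩ := h₁ r hr hrs hσ
  obtain ⟨m₂, v₂, b1, b2, b3, b4, b5⟩ := h₂ r hr hrs hσ
  set ε := (√(N : ℝ))⁻¹ with hε
  have hε0 : 0 ≤ ε := by positivity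
  have up1 : C₁ * ε ≤ C * ε := by gcongr; linarith
  have up2 : C₂ * ε ≤ C * ε := by gcongr; linarith
  have hk₁ : 0 ≤ m₁ ^ 2 / (2 * v₁) := div_nonneg (sq_nonneg _) (by linarith)
  have hk₂ : 0 ≤ m₂ ^ 2 / (2 * v₂) := div_nonneg (sq_nonneg _) (by linarith)
  have hk : |m₁ ^ 2 / (2 * v₁) + m₂ ^ 2 / (2 * v₂) - κ| ≤ 2 * (C * ε) := by
    have e : m₁ ^ 2 / (2 * v₁) + m₂ ^ 2 / (2 * v₂) - κ =
        (m₁ ^ 2 / (2 * v₁) - (x 0 - y 0) ^ 2 / 2) +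
          (m₂ ^ 2 / (2 * v₂) - (x 1 - y 1) ^ 2 / 2) := by rw [hκe]; ring
    rw [e]
    refine (abs_add_le _ _).trans ?_
    linarith
  have hQ : r * varRate s t r ≤ 2 * s := by
    have : varRate s t r ≤ 2 := by
      rw [varRate]
      have : 0 < r / s := by positivity
      have : 0 < r / t := by positivity
      linarith
    nlinarith
  rw [binomialKernel, Fin.prod_univ_two, limitKernel]
  have hq0 : 0 < r * varRate s t r := by positivity
  refine abs_mul_sub_gauss_le hq0 hQ hC0.le hε0 hεA (by positivity) (a1.trans up1) a2
    (b1.trans up2) b2 b3 hk₁ hk₂ hk ?_ hκ0 (hZ r hr hrs hσ) (a5.trans (by gcongr))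
    (b5.trans (by gcongr))
  rcases h₃ with h | h
  · linarith [(abs_le.1 hk).1]
  · linarith

/-! ### Heat kernel: continuity in time and Chapman-Kolmogorov. -/

/-- The heat kernel as a function of the squared distance and the time. -/
noncomputable def radial (d w : ℝ) : ℝ := (1 / (2 * Real.pi * w)) * Real.exp (-d / (2 * w))

lemma heatKernel_eq_radial (t : ℝ) (x y : Plane) : heatKernel t x y = radial (‖x - y‖ ^ 2) t := rfl

lemma radial_nonneg {d w : ℝ} (hw : 0 ≤ w) : 0 ≤ radial d w := by
  unfold radial; positivity

lemma radial_le {d w : ℝ} (hd : 0 ≤ d) (hw : 0 < w) : radial d w ≤ 1 / (2 * Real.pi * w) := by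
  unfold radial
  refine mul_le_of_le_one_right (by positivity) ?_
  rw [Real.exp_le_one_iff, neg_div, neg_nonpos]
  positivity

lemma continuousAt_radial (d : ℝ) {w : ℝ} (hw : 0 < w) : ContinuousAt (radial d) w := by
  have h1 : 2 * Real.pi * w ≠ 0 := by positivity
  have h2 : 2 * w ≠ 0 := by positivity
  unfold radial
  fun_prop (disch := assumption)

/-- Continuity up to time `0` is what the case `s = t`, `x ≠ y` requires, since then `1/s - 1/t =
0`. -/
lemma continuousOn_radial {d δ : ℝ} (hδ : 0 ≤ δ) (h : 0 < δ ∨ 0 < d) :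
    ContinuousOn (radial d) (Set.Ici δ) := by
  intro w hw
  rcases (hδ.trans hw).eq_or_lt with h0 | h0
  · have hd0 : 0 < d := by
      rcases h with h | h
      · exact absurd (h.trans_le hw) (by rw [← h0]; exact lt_irrefl _)
      · exact h
    subst h0
    -- Division by zero returns `0`, which is also the limit at `0` when `d > 0`.
    have hz : radial d 0 = 0 := by simp [radial]
    refine ContinuousWithinAt.mono ?_ (Set.Ici_subset_Ici.2 hδ)
    rw [ContinuousWithinAt, hz]
    have hup : Tendsto (fun w : ℝ => 8 / d ^ 2 * w) (𝓝[≥] 0) (𝓝 0) := by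
      have : Tendsto (fun w : ℝ => 8 / d ^ 2 * w) (𝓝 0) (𝓝 (8 / d ^ 2 * 0)) :=
        (continuous_const.mul continuous_id).tendsto 0
      rw [mul_zero] at this
      exact this.mono_left nhdsWithin_le_nhds
    refine tendsto_of_tendsto_of_tendsto_of_le_of_le' tendsto_const_nhds hup
      (eventually_mem_nhdsWithin.mono fun w hw => radial_nonneg hw)
      (eventually_mem_nhdsWithin.mono fun w hw => ?_)
    rcases (show (0 : ℝ) ≤ w from hw).eq_or_lt with h0 | h0
    · rw [← h0, hz, mul_zero]
    · have hq := Real.quadratic_le_exp_of_nonneg (by positivity : 0 ≤ d / (2 * w))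
      have hz0 : 0 < d / (2 * w) := by positivity
      have he : Real.exp (-d / (2 * w)) ≤ 8 * w ^ 2 / d ^ 2 := by
        rw [neg_div, Real.exp_neg, inv_le_comm₀ (Real.exp_pos _) (by positivity)]
        have : (8 * w ^ 2 / d ^ 2)⁻¹ = (d / (2 * w)) ^ 2 / 2 := by field_simp; norm_num
        rw [this]; nlinarith
      unfold radial
      calc _ ≤ 1 / (2 * Real.pi * w) * (8 * w ^ 2 / d ^ 2) := by gcongr
        _ = (8 / d ^ 2 * w) * (1 / (2 * Real.pi)) := by field_simp
        _ ≤ (8 / d ^ 2 * w) * 1 := by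
            gcongr
            rw [div_le_one (by positivity)]
            linarith [Real.pi_gt_three]
        _ = _ := mul_one _
  · exact (continuousAt_radial d h0).continuousWithinAt

lemma heatKernel_nonneg {t : ℝ} (ht : 0 ≤ t) (x y : Plane) : 0 ≤ heatKernel t x y :=
  radial_nonneg ht

lemma heatKernel_comm (t : ℝ) (x y : Plane) : heatKernel t x y = heatKernel t y x := by
  rw [heatKernel, heatKernel, norm_sub_rev]

/-- Completing the square in `z`. It yields both integrability of the product and the
Chapman-Kolmogorov equation. -/
lemma heatKernel_mul_heatKernel {a b : ℝ} (ha : 0 < a) (hb : 0 < b) (x y z : Plane) :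
    heatKernel a z x * heatKernel b z y = heatKernel (a + b) x y *
      heatKernel (a * b / (a + b)) z ((b / (a + b)) • x + (a / (a + b)) • y) := by
  have hpi := Real.pi_pos
  unfold heatKernel
  rw [mul_mul_mul_comm, mul_mul_mul_comm (1 / (2 * Real.pi * (a + b))), ← Real.exp_add,
    ← Real.exp_add]
  congr 1
  · field_simp
  · congr 1
    simp only [EuclideanSpace.norm_sq_eq, Fin.sum_univ_two, Real.norm_eq_abs, sq_abs,
      PiLp.sub_apply, PiLp.add_apply, PiLp.smul_apply, smul_eq_mul]
    field_simp
    ring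

lemma integral_heatKernel {a : ℝ} (ha : 0 < a) (x : Plane) : ∫ z, heatKernel a z x = 1 := by
  unfold heatKernel
  rw [integral_const_mul, integral_sub_right_eq_self (fun z : Plane =>
    Real.exp (-(‖z‖ ^ 2) / (2 * a))) x]
  have h := GaussianFourier.integral_rexp_neg_mul_sq_norm (V := Plane)
    (b := 1 / (2 * a)) (by positivity)
  have e : (fun z : Plane => Real.exp (-(‖z‖ ^ 2) / (2 * a))) =
      fun z => Real.exp (-(1 / (2 * a)) * ‖z‖ ^ 2) := by
    ext z; congr 1; ring
  rw [e, h]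
  simp
  have := Real.pi_pos
  field_simp

lemma integrable_heatKernel {a : ℝ} (ha : 0 < a) (x : Plane) :
    Integrable fun z => heatKernel a z x := by
  -- A nonintegrable function has integral `0` by convention, but this integral is `1`.
  by_contra h
  have := integral_heatKernel ha x
  rw [integral_undef h] at this
  exact zero_ne_one this

lemma integrable_heatKernel_mul {a b : ℝ} (ha : 0 < a) (hb : 0 < b) (x y : Plane) :
    Integrable fun z => heatKernel a z x * heatKernel b z y := by
  simp_rw [heatKernel_mul_heatKernel ha hb]
  exact (integrable_heatKernel (by positivity) _).const_mul _

/-- The Chapman-Kolmogorov equation. -/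
lemma integral_heatKernel_mul {a b : ℝ} (ha : 0 < a) (hb : 0 < b) (x y : Plane) :
    ∫ z, heatKernel a z x * heatKernel b z y = heatKernel (a + b) x y := by
  simp_rw [heatKernel_mul_heatKernel ha hb]
  rw [integral_const_mul, integral_heatKernel (by positivity), mul_one]

/-! ### The logarithm as a regularised time integral of heat kernels. -/

lemma integrableOn_Ioi_of_bound {f : ℝ → ℝ} (hf : Measurable f) {c A B : ℝ} (hc : 0 < c)
    (hA : ∀ w, 0 < w → w < c → |f w| ≤ A) (hB : ∀ w, c ≤ w → |f w| ≤ B / w ^ 2) :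
    IntegrableOn f (Set.Ioi 0) := by
  have hu : Set.Ioi (0 : ℝ) = Set.Ioo 0 c ∪ Set.Ici c := (Set.Ioo_union_Ici_eq_Ioi hc).symm
  rw [hu]
  refine IntegrableOn.union ?_ ?_
  · refine Measure.integrableOn_of_bounded (M := A) (by simp) hf.aestronglyMeasurable ?_
    exact (ae_restrict_iff' measurableSet_Ioo).2 (ae_of_all _ fun w hw => hA w hw.1 hw.2)
  · rw [integrableOn_Ici_iff_integrableOn_Ioi]
    have h : IntegrableOn (fun w : ℝ => B * w ^ (-2 : ℝ)) (Set.Ioi c) :=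
      (integrableOn_Ioi_rpow_of_lt (by norm_num) hc).const_mul B
    refine Integrable.mono' h hf.aestronglyMeasurable ?_
    refine (ae_restrict_iff' measurableSet_Ioi).2 (ae_of_all _ fun w hw => ?_)
    have hw0 : 0 < w := hc.trans hw
    refine (hB w (le_of_lt hw)).trans (le_of_eq ?_)
    rw [Real.rpow_neg hw0.le, div_eq_mul_inv]
    norm_cast

lemma indicatorGeOne_of_le {v : ℝ} (hv : 1 ≤ v) : indicatorGeOne v = 1 := by
  simp [indicatorGeOne, hv]

lemma indicatorGeOne_of_lt {v : ℝ} (hv : v < 1) : indicatorGeOne v = 0 := by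
  simp [indicatorGeOne, hv]

lemma measurable_indicatorGeOne : Measurable indicatorGeOne :=
  measurable_const.indicator measurableSet_Ici

lemma measurable_constIntegrand : Measurable constIntegrand := by
  unfold constIntegrand
  have := measurable_indicatorGeOne
  fun_prop

lemma integrableOn_constIntegrand : IntegrableOn constIntegrand (Set.Ioi 0) := by
  have hpi := Real.pi_gt_three
  refine integrableOn_Ioi_of_bound (A := 1) (B := 1) measurable_constIntegrand one_pos
    (fun w hw hw1 => ?_) (fun w hw => ?_)
  · rw [constIntegrand, indicatorGeOne_of_lt hw1, sub_zero, abs_of_nonneg (by positivity),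
      div_le_one (by positivity), Real.exp_neg]
    have h := Real.add_one_le_exp (1 / (4 * w))
    refine (inv_anti₀ (by positivity : 0 < 1 / (4 * w)) (by linarith)).trans ?_
    rw [one_div, inv_inv]
    nlinarith
  · have hw0 : 0 < w := by linarith
    have h := Real.add_one_le_exp (-(1 / (4 * w)))
    have h1 : Real.exp (-(1 / (4 * w))) ≤ 1 := by
      rw [Real.exp_le_one_iff, neg_nonpos]; positivity
    rw [constIntegrand, indicatorGeOne_of_le hw, abs_div, abs_of_nonpos (by linarith),
      abs_of_pos (by positivity : 0 < 4 * Real.pi * w), div_le_div_iff₀ (by positivity)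
      (by positivity)]
    have h2 : -(Real.exp (-(1 / (4 * w))) - 1) ≤ 1 / (4 * w) := by linarith
    calc _ ≤ 1 / (4 * w) * w ^ 2 := by gcongr
      _ = w / 4 := by field_simp
      _ ≤ 1 * (4 * Real.pi * w) := by nlinarith

/-- The integrand that represents the logarithm of the distance. -/
noncomputable def logKernel (d w : ℝ) : ℝ :=
  (Real.exp (-d / (2 * w)) - indicatorGeOne (w / 2)) / (4 * Real.pi * w)

lemma logKernel_eq (d w : ℝ) :
    logKernel d w = 1 / 2 * radial d w - indicatorGeOne (w / 2) / (4 * Real.pi * w) := by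
  rw [logKernel, radial, sub_div]
  congr 1
  by_cases hw : w = 0
  · simp [hw]
  · have := Real.pi_pos
    field_simp
    norm_num

/-- The truncation of `1/w` can be moved at the cost of a logarithm. -/
lemma integral_indicator_sub {a b : ℝ} (ha : 0 < a) (hb : 0 < b) :
    IntegrableOn (fun w => (indicatorGeOne (w / a) - indicatorGeOne (w / b)) / (4 * Real.pi * w))
      (Set.Ioi 0) ∧
    ∫ w in Set.Ioi 0, (indicatorGeOne (w / a) - indicatorGeOne (w / b)) / (4 * Real.pi * w) =
      (Real.log b - Real.log a) / (4 * Real.pi) := by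
  wlog hab : a ≤ b generalizing a b
  · obtain ⟨h1, h2⟩ := this hb ha (by linarith)
    have e : (fun w => (indicatorGeOne (w / a) - indicatorGeOne (w / b)) / (4 * Real.pi * w)) =
        fun w => -((indicatorGeOne (w / b) - indicatorGeOne (w / a)) / (4 * Real.pi * w)) := by
      ext w; ring
    rw [e]
    refine ⟨h1.neg, ?_⟩
    rw [integral_neg, h2]; ring
  have hpi := Real.pi_pos
  have e : (fun w => (indicatorGeOne (w / a) - indicatorGeOne (w / b)) / (4 * Real.pi * w)) =
      Set.indicator (Set.Ico a b) fun w => 1 / (4 * Real.pi) * (1 / w) := by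
    ext w
    by_cases h1 : a ≤ w
    · rw [indicatorGeOne_of_le ((one_le_div ha).2 h1)]
      by_cases h2 : w < b
      · rw [indicatorGeOne_of_lt ((div_lt_one hb).2 h2),
          Set.indicator_of_mem (show w ∈ Set.Ico a b from ⟨h1, h2⟩)]
        rw [sub_zero, one_div_mul_one_div]
      · rw [indicatorGeOne_of_le ((one_le_div hb).2 (by linarith)),
          Set.indicator_of_notMem (fun h => h2 h.2)]
        simp
    · rw [indicatorGeOne_of_lt ((div_lt_one ha).2 (by linarith)),
        indicatorGeOne_of_lt ((div_lt_one hb).2 (by linarith)),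
        Set.indicator_of_notMem (fun h => h1 h.1)]
      simp
  have hsub : Set.Ico a b ⊆ Set.Ioi 0 := fun w hw => ha.trans_le hw.1
  have hint : IntegrableOn (fun w : ℝ => 1 / (4 * Real.pi) * (1 / w)) (Set.Ico a b) := by
    refine IntegrableOn.mono_set ?_ Set.Ico_subset_Icc_self
    refine ContinuousOn.integrableOn_Icc (fun w hw => ContinuousAt.continuousWithinAt ?_)
    have : w ≠ 0 := (ha.trans_le hw.1).ne'
    fun_prop (disch := assumption)
  rw [e]
  constructor
  · exact ((integrable_indicator_iff measurableSet_Ico).2 hint).integrableOn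
  · rw [setIntegral_indicator measurableSet_Ico, Set.inter_eq_right.2 hsub,
      integral_Ico_eq_integral_Ioo, ← integral_Ioc_eq_integral_Ioo,
      ← intervalIntegral.integral_of_le hab, intervalIntegral.integral_const_mul,
      integral_one_div_of_pos ha hb, Real.log_div hb.ne' ha.ne']
    ring

/-- The scaling `w = 2 d v` gives `constIntegrand` with the cutoff at `2 d` instead of `2`; moving
the cutoff back costs `log d`. -/
lemma integral_logKernel {d : ℝ} (hd : 0 < d) :
    ∫ w in Set.Ioi 0, logKernel d w =
      (∫ v in Set.Ioi 0, constIntegrand v) - Real.log d / (4 * Real.pi) := by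
  have hpi := Real.pi_pos
  obtain ⟨h1, h2⟩ := integral_indicator_sub (by positivity : 0 < 2 * d) two_pos
  have hc : 0 < (2 * d)⁻¹ := by positivity
  have hscale := integral_comp_mul_left_Ioi constIntegrand 0 hc
  have hscaleInt := (integrableOn_Ioi_comp_mul_left_iff constIntegrand 0 hc).2
    (by rw [mul_zero]; exact integrableOn_constIntegrand)
  rw [mul_zero, inv_inv, smul_eq_mul] at hscale
  have e : ∀ w ∈ Set.Ioi (0 : ℝ), logKernel d w = (2 * d)⁻¹ * constIntegrand ((2 * d)⁻¹ * w) +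
      (indicatorGeOne (w / (2 * d)) - indicatorGeOne (w / 2)) / (4 * Real.pi * w) := by
    intro w hw
    have hw0 : 0 < w := hw
    rw [logKernel, constIntegrand]
    have e1 : -d / (2 * w) = -(1 / (4 * ((2 * d)⁻¹ * w))) := by field_simp; norm_num
    have e2 : (2 * d)⁻¹ * w = w / (2 * d) := by ring
    rw [e1, e2]
    field_simp
    ring
  rw [setIntegral_congr_fun measurableSet_Ioi e, integral_add (hscaleInt.const_mul _) h1,
    integral_const_mul, hscale, h2, Real.log_mul two_ne_zero hd.ne']
  field_simp
  ring

/-- The radial average of `logKernel`. -/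
noncomputable def averagedLogKernel (τ d w : ℝ) : ℝ :=
  1 / 2 * radial d (τ + w) - indicatorGeOne (w / 2) / (4 * Real.pi * w)

/-- The shift by `τ > 0` removes the singularity at `0`; at infinity the `1 / w` terms cancel and
leave `O((τ + d) / w²)`. -/
lemma integrableOn_averagedLogKernel {τ d : ℝ} (hτ : 0 < τ) (hd : 0 ≤ d) :
    IntegrableOn (averagedLogKernel τ d) (Set.Ioi 0) := by
  have hpi := Real.pi_gt_three
  have hm : Measurable (averagedLogKernel τ d) := by
    unfold averagedLogKernel radial
    have := measurable_indicatorGeOne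
    fun_prop
  refine integrableOn_Ioi_of_bound (A := 1 / τ) (B := τ + d) hm two_pos
    (fun w hw hw1 => ?_) (fun w hw => ?_)
  · rw [averagedLogKernel, indicatorGeOne_of_lt (by linarith), zero_div, sub_zero,
      abs_of_nonneg (mul_nonneg (by norm_num) (radial_nonneg (by linarith)))]
    have h := radial_le hd (by linarith : 0 < τ + w)
    have h2 : 1 / (2 * Real.pi * (τ + w)) ≤ 1 / τ := by
      apply one_div_le_one_div_of_le hτ; nlinarith
    have h3 : 0 ≤ radial d (τ + w) := radial_nonneg (by linarith)
    linarith
  · have hw0 : 0 < w := by linarith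
    have hτw : 0 < τ + w := by linarith
    rw [averagedLogKernel, indicatorGeOne_of_le (by linarith)]
    have hr := radial_le hd hτw
    have h1 : 1 / (2 * Real.pi * (τ + w)) ≤ 1 / (2 * Real.pi * w) := by gcongr; linarith
    have h2 : 1 / (4 * Real.pi * w) = 1 / 2 * (1 / (2 * Real.pi * w)) := by field_simp; norm_num
    rw [abs_of_nonpos (by rw [h2]; linarith)]
    have he := Real.add_one_le_exp (-d / (2 * (τ + w)))
    have hrl : 1 / (2 * Real.pi * (τ + w)) * (-d / (2 * (τ + w)) + 1) ≤ radial d (τ + w) := by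
      unfold radial; gcongr
    have h3 : -(1 / 2 * radial d (τ + w) - 1 / (4 * Real.pi * w)) ≤
        1 / (4 * Real.pi * w) - 1 / (4 * Real.pi * (τ + w)) * (1 - d / (2 * (τ + w))) := by
      have : 1 / (4 * Real.pi * (τ + w)) * (1 - d / (2 * (τ + w))) =
        1 / 2 * (1 / (2 * Real.pi * (τ + w)) * (-d / (2 * (τ + w)) + 1)) := by
        field_simp; ring
      rw [this]; linarith
    refine h3.trans ?_
    have h4 : 1 / (4 * Real.pi * w) - 1 / (4 * Real.pi * (τ + w)) * (1 - d / (2 * (τ + w))) =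
        1 / (4 * Real.pi) * (τ / (w * (τ + w)) + d / 2 / (τ + w) ^ 2) := by
      field_simp; ring
    rw [h4]
    have h5 : τ / (w * (τ + w)) ≤ τ / w ^ 2 := by
      gcongr; nlinarith
    have h6 : d / 2 / (τ + w) ^ 2 ≤ d / w ^ 2 := by
      gcongr <;> linarith
    have h7 : 1 / (4 * Real.pi) ≤ 1 := by rw [div_le_one (by positivity)]; linarith
    have h8 : 0 ≤ τ / (w * (τ + w)) + d / 2 / (τ + w) ^ 2 := by positivity
    calc _ ≤ 1 * (τ / (w * (τ + w)) + d / 2 / (τ + w) ^ 2) := by gcongr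
      _ ≤ τ / w ^ 2 + d / w ^ 2 := by rw [one_mul]; linarith
      _ = _ := by rw [add_div]

lemma integrable_and_integral_heatKernel_triple {a b w : ℝ} (ha : 0 < a) (hb : 0 < b)
    (hw : 0 < w) (x y : Plane) :
    Integrable (fun p : Plane × Plane =>
      heatKernel a p.1 x * heatKernel b p.2 y * radial (‖p.1 - p.2‖ ^ 2) w) ∧
    ∫ p : Plane × Plane, heatKernel a p.1 x * heatKernel b p.2 y * radial (‖p.1 - p.2‖ ^ 2) w =
      radial (‖x - y‖ ^ 2) (a + b + w) := by
  have hQ : Integrable fun p : Plane × Plane => heatKernel a p.1 x * heatKernel b p.2 y :=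
    (integrable_heatKernel ha x).mul_prod (integrable_heatKernel hb y)
  have hi : Integrable (fun p : Plane × Plane =>
      heatKernel a p.1 x * heatKernel b p.2 y * radial (‖p.1 - p.2‖ ^ 2) w) := by
    refine hQ.mul_bdd (c := 1 / (2 * Real.pi * w)) ?_ (ae_of_all _ fun p => ?_)
    · refine Measurable.aestronglyMeasurable ?_
      unfold radial; fun_prop
    · rw [Real.norm_of_nonneg (radial_nonneg hw.le)]
      exact radial_le (by positivity) hw
  refine ⟨hi, ?_⟩
  rw [Measure.volume_eq_prod, integral_prod _ hi]
  have h1 (y' : Plane) : ∫ y'' : Plane, heatKernel a y' x * heatKernel b y'' y *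
      radial (‖y' - y''‖ ^ 2) w = heatKernel a y' x * heatKernel (b + w) y' y := by
    have e : ∀ y'' : Plane, heatKernel a y' x * heatKernel b y'' y * radial (‖y' - y''‖ ^ 2) w =
        heatKernel a y' x * (heatKernel b y'' y * heatKernel w y'' y') := by
      intro y''
      rw [mul_assoc, heatKernel_comm w, heatKernel_eq_radial w]
    simp_rw [e]
    rw [integral_const_mul, integral_heatKernel_mul hb hw, heatKernel_comm (b + w)]
  simp_rw [h1]
  rw [integral_heatKernel_mul ha (by positivity), heatKernel_eq_radial, add_assoc]

/-- The sign depends on `w` alone, so taking absolute values commutes with averaging over the plane.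
Fubini's hypothesis thus reduces to integrability of `averagedLogKernel`. -/
lemma norm_logKernel {d w : ℝ} (hd : 0 ≤ d) (hw : 0 < w) :
    ‖logKernel d w‖ = (if w < 2 then 1 else -1) * logKernel d w := by
  have hpi := Real.pi_pos
  rw [Real.norm_eq_abs, logKernel]
  split_ifs with h
  · rw [indicatorGeOne_of_lt (by linarith), sub_zero, one_mul, abs_of_nonneg (by positivity)]
  · rw [indicatorGeOne_of_le (by linarith), neg_one_mul]
    refine abs_of_nonpos (div_nonpos_of_nonpos_of_nonneg ?_ (by positivity))
    rw [sub_nonpos, Real.exp_le_one_iff, neg_div, neg_nonpos]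
    positivity

/-- The logarithmic term. -/
lemma integrable_and_integral_logIntegrand {s t : ℝ} (hs : 0 < s) (ht : 0 < t) (x y : Plane) :
    Integrable (fun p : Plane × Plane => logIntegrand s t x y p.1 p.2) ∧
    1 / (2 * Real.pi) * (∫ y' : Plane, ∫ y'' : Plane, logIntegrand s t x y y' y'') =
      (∫ w in Set.Ioi 0, averagedLogKernel (1 / s + 1 / t) (‖x - y‖ ^ 2) w) -
        ∫ v in Set.Ioi 0, constIntegrand v := by
  have hpi := Real.pi_pos
  set a := 1 / s with ha
  set b := 1 / t with hb
  have ha0 : 0 < a := by positivity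
  have hb0 : 0 < b := by positivity
  set Q : Plane × Plane → ℝ := fun p => heatKernel a p.1 x * heatKernel b p.2 y with hQ
  have hQi : Integrable Q :=
    (integrable_heatKernel ha0 x).mul_prod (integrable_heatKernel hb0 y)
  have hQ1 : ∫ p, Q p = 1 := by
    rw [Measure.volume_eq_prod]
    simp only [hQ]
    rw [integral_prod_mul (fun z => heatKernel a z x) (fun z => heatKernel b z y), integral_heatKernel ha0,
      integral_heatKernel hb0, one_mul]
  have hQ0 : ∀ p, 0 ≤ Q p := fun p =>
    mul_nonneg (heatKernel_nonneg ha0.le _ _) (heatKernel_nonneg hb0.le _ _)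
  set ν : Measure ℝ := volume.restrict (Set.Ioi 0) with hν
  set F : (Plane × Plane) × ℝ → ℝ := fun z => Q z.1 * logKernel (‖z.1.1 - z.1.2‖ ^ 2) z.2 with hF
  have hFm : Measurable F := by
    simp only [hF, hQ, heatKernel, logKernel]
    have := measurable_indicatorGeOne
    fun_prop
  have hslice : ∀ w, 0 < w → Integrable (fun p => F (p, w)) ∧
      ∫ p, F (p, w) = averagedLogKernel (a + b) (‖x - y‖ ^ 2) w := by
    intro w hw
    obtain ⟨h1, h2⟩ := integrable_and_integral_heatKernel_triple ha0 hb0 hw x y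
    have e : (fun p => F (p, w)) = fun p : Plane × Plane =>
        1 / 2 * (heatKernel a p.1 x * heatKernel b p.2 y * radial (‖p.1 - p.2‖ ^ 2) w) -
          indicatorGeOne (w / 2) / (4 * Real.pi * w) * Q p := by
      ext p
      simp only [hF, hQ, logKernel_eq]
      ring
    rw [e]
    refine ⟨(h1.const_mul _).sub (hQi.const_mul _), ?_⟩
    rw [integral_sub (h1.const_mul _) (hQi.const_mul _), integral_const_mul, integral_const_mul,
      h2, hQ1, mul_one, averagedLogKernel]
  have hFi : Integrable F ((volume : Measure (Plane × Plane)).prod ν) := by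
    rw [integrable_prod_iff' hFm.aestronglyMeasurable]
    constructor
    · exact (ae_restrict_iff' measurableSet_Ioi).2 (ae_of_all _ fun w hw => (hslice w hw).1)
    · have hI := (integrableOn_averagedLogKernel (by positivity : 0 < a + b)
        (by positivity : 0 ≤ ‖x - y‖ ^ 2)).norm
      refine hI.congr ((ae_restrict_iff' measurableSet_Ioi).2 (ae_of_all _ fun w hw => ?_))
      have e : ∀ p, ‖F (p, w)‖ = (if w < 2 then 1 else -1) * F (p, w) := by
        intro p
        simp only [hF]
        rw [norm_mul, Real.norm_of_nonneg (hQ0 p), norm_logKernel (by positivity) hw]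
        ring
      have habs : ‖∫ p, F (p, w)‖ = ∫ p, ‖F (p, w)‖ := by
        have h1 : ∫ p, ‖F (p, w)‖ = (if w < 2 then 1 else -1) * ∫ p, F (p, w) := by
          simp_rw [e]; rw [integral_const_mul]
        have h2 : 0 ≤ ∫ p, ‖F (p, w)‖ := integral_nonneg fun p => norm_nonneg _
        rw [← Real.norm_of_nonneg h2, h1, norm_mul]
        split_ifs <;> simp
      change ‖averagedLogKernel (a + b) (‖x - y‖ ^ 2) w‖ = _
      rw [← (hslice w hw).2, habs]
  have hswap : ∫ p : Plane × Plane, ∫ w, F (p, w) ∂ν =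
      ∫ w in Set.Ioi 0, averagedLogKernel (a + b) (‖x - y‖ ^ 2) w := by
    rw [integral_integral_swap (f := fun p w => F (p, w)) hFi]
    exact setIntegral_congr_fun measurableSet_Ioi fun w hw => (hslice w hw).2
  have hdiag : ∀ᵐ p : Plane × Plane, p.1 ≠ p.2 := by
    rw [Measure.volume_eq_prod]
    refine (Measure.ae_prod_iff_ae_ae ?_).2 (ae_of_all _ fun y' => ?_)
    · exact (measurableSet_eq_fun measurable_fst measurable_snd).compl
    · have : ∀ᵐ z : Plane, z ≠ y' := by
        rw [ae_iff]; simp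
      exact this.mono fun z hz => hz.symm
  -- Off the null diagonal the logarithm is recovered from the time integral; this identity
  -- transfers both integrability and the value of the integral.
  have hlog : ∀ᵐ p : Plane × Plane, 2 * Real.pi * ((∫ w, F (p, w) ∂ν) -
      (∫ v in Set.Ioi 0, constIntegrand v) * Q p) = logIntegrand s t x y p.1 p.2 := by
    filter_upwards [hdiag] with p hp
    have hd : 0 < ‖p.1 - p.2‖ := norm_pos_iff.2 (sub_ne_zero.2 hp)
    simp only [hF]
    rw [integral_const_mul, hν, integral_logKernel (by positivity), Real.log_pow, logIntegrand]
    simp only [hQ]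
    push_cast
    field_simp
    ring
  have hli : Integrable (fun p : Plane × Plane => logIntegrand s t x y p.1 p.2) :=
    ((hFi.integral_prod_left.sub (hQi.const_mul _)).const_mul (2 * Real.pi)).congr hlog
  refine ⟨hli, ?_⟩
  have hint : ∫ p : Plane × Plane, logIntegrand s t x y p.1 p.2 =
      2 * Real.pi * ((∫ w in Set.Ioi 0, averagedLogKernel (a + b) (‖x - y‖ ^ 2) w) -
        ∫ v in Set.Ioi 0, constIntegrand v) := by
    rw [← integral_congr_ae hlog, integral_const_mul,
      integral_sub hFi.integral_prod_left (hQi.const_mul _), hswap, integral_const_mul, hQ1,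
      mul_one]
  have hprod := integral_prod (μ := (volume : Measure Plane)) (ν := (volume : Measure Plane)) _ hli
  rw [← hprod, ← Measure.volume_eq_prod, hint, one_div, inv_mul_cancel_left₀ (by positivity)]

/-! ### The heat term and the integral of the limiting kernel. -/

/-- The heat kernel term. -/
lemma integrable_and_integral_heatIntegrand {s t : ℝ} {x y : Plane} (hs : 0 < s) (hst : s ≤ t)
    (hxy : s < t ∨ x ≠ y) :
    IntegrableOn (fun p : ℝ × Plane => heatIntegrand s t x y p.1 p.2)
      (Set.Ioo 0 (1 / t) ×ˢ Set.univ) ∧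
    ∫ r in (0 : ℝ)..(1 / t), ∫ z : Plane, heatIntegrand s t x y r z =
      1 / 2 * ∫ w in (1 / s - 1 / t)..(1 / s + 1 / t), radial (‖x - y‖ ^ 2) w := by
  have ht : 0 < t := hs.trans_le hst
  have hts : 1 / t ≤ 1 / s := one_div_le_one_div_of_le hs hst
  have ht0 : 0 < 1 / t := by positivity
  set δ := 1 / s - 1 / t with hδ
  have hδ0 : 0 ≤ δ := by linarith
  set d := ‖x - y‖ ^ 2 with hd
  have hcont : ContinuousOn (radial d) (Set.Ici δ) := by
    refine continuousOn_radial hδ0 ?_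
    rcases hxy with h | h
    · left; rw [hδ, sub_pos]; exact one_div_lt_one_div_of_lt hs h
    · right
      have : 0 < ‖x - y‖ := norm_pos_iff.2 (sub_ne_zero.2 h)
      positivity
  have hinner : ∀ r ∈ Set.Ioo 0 (1 / t), Integrable (fun z => heatIntegrand s t x y r z) ∧
      ∫ z, heatIntegrand s t x y r z = radial d (1 / s + 1 / t - 2 * r) := by
    intro r hr
    have h1 : 0 < 1 / s - r := by linarith [hr.2]
    have h2 : 0 < 1 / t - r := by linarith [hr.2]
    refine ⟨integrable_heatKernel_mul h1 h2 x y, ?_⟩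
    simp only [heatIntegrand]
    rw [integral_heatKernel_mul h1 h2, heatKernel_eq_radial]
    congr 1; ring
  constructor
  · have hm : Measurable fun p : ℝ × Plane => heatIntegrand s t x y p.1 p.2 := by
      simp only [heatIntegrand, heatKernel]; fun_prop
    rw [IntegrableOn, Measure.volume_eq_prod, ← Measure.prod_restrict, Measure.restrict_univ,
      integrable_prod_iff hm.aestronglyMeasurable]
    constructor
    · exact (ae_restrict_iff' measurableSet_Ioo).2 (ae_of_all _ fun r hr => (hinner r hr).1)
    · have hI : IntegrableOn (fun r => radial d (1 / s + 1 / t - 2 * r)) (Set.Ioo 0 (1 / t)) := by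
        refine IntegrableOn.mono_set (t := Set.Icc 0 (1 / t)) ?_ Set.Ioo_subset_Icc_self
        refine ContinuousOn.integrableOn_Icc ?_
        refine hcont.comp (by fun_prop) fun r hr => ?_
        rw [Set.mem_Ici, hδ]; linarith [hr.2]
      refine hI.congr ((ae_restrict_iff' measurableSet_Ioo).2 (ae_of_all _ fun r hr => ?_))
      change radial d (1 / s + 1 / t - 2 * r) = _
      rw [← (hinner r hr).2]
      refine integral_congr_ae (ae_of_all _ fun z => ?_)
      refine (Real.norm_of_nonneg (mul_nonneg ?_ ?_)).symm <;>
        exact heatKernel_nonneg (by linarith [hr.2]) _ _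
  · rw [intervalIntegral.integral_of_le ht0.le, integral_Ioc_eq_integral_Ioo,
      setIntegral_congr_fun measurableSet_Ioo fun r hr => (hinner r hr).2,
      ← integral_Ioc_eq_integral_Ioo, ← intervalIntegral.integral_of_le ht0.le,
      intervalIntegral.integral_comp_sub_mul _ two_ne_zero]
    rw [smul_eq_mul, one_div (2 : ℝ)]
    congr 2 <;> ring

/-- Prepares the substitution `w = 2/r - (1/s + 1/t)`, whose derivative `-2 / r²` accounts for the
factor `1 / r²`. -/
lemma limitKernel_eq_radial {s t r : ℝ} (hr : 0 < r) (x y : Plane) :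
    limitKernel x y r s t = radial (‖x - y‖ ^ 2) (2 / r - (1 / s + 1 / t)) / r ^ 2 := by
  have e : 2 / r - (1 / s + 1 / t) = varRate s t r / r := by
    rw [varRate]; field_simp; ring
  rw [e, limitKernel, radial]
  generalize varRate s t r = σ
  by_cases hσ : σ = 0
  · simp [hσ]
  · have h1 : -‖x - y‖ ^ 2 / (2 * (σ / r)) = -(r / σ * (‖x - y‖ ^ 2 / 2)) := by field_simp
    rw [h1]
    have := Real.pi_pos
    field_simp

lemma integral_limitKernel {s t A B : ℝ} {x y : Plane} (hA : 0 < A) (hAB : A ≤ B) (hBs : B ≤ s)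
    (hcont : ContinuousOn (radial (‖x - y‖ ^ 2)) (Set.Ici (1 / s - 1 / t))) :
    IntervalIntegrable (fun r => limitKernel x y r s t) volume A B ∧
    ∫ r in A..B, limitKernel x y r s t =
      1 / 2 * ∫ w in (2 / B - (1 / s + 1 / t))..(2 / A - (1 / s + 1 / t)),
        radial (‖x - y‖ ^ 2) w := by
  set d := ‖x - y‖ ^ 2
  set τ := 1 / s + 1 / t with hτ
  have hpos : ∀ r ∈ Set.uIcc A B, 0 < r ∧ r ≤ s := by
    intro r hr
    rw [Set.uIcc_of_le hAB] at hr
    exact ⟨hA.trans_le hr.1, hr.2.trans hBs⟩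
  have hmap : ∀ r ∈ Set.uIcc A B, 2 / r - τ ∈ Set.Ici (1 / s - 1 / t) := by
    intro r hr
    obtain ⟨h0, h1⟩ := hpos r hr
    have : 2 / s ≤ 2 / r := by gcongr
    have e : 2 / s = 1 / s + 1 / s := by ring
    rw [Set.mem_Ici, hτ]; linarith
  have hfc : ContinuousOn (fun r : ℝ => 2 / r - τ) (Set.uIcc A B) := fun r hr => by
    have : r ≠ 0 := (hpos r hr).1.ne'
    exact ContinuousAt.continuousWithinAt (by fun_prop (disch := assumption))
  have hinv : ContinuousOn (fun r : ℝ => -2 / r ^ 2) (Set.uIcc A B) := fun r hr => by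
    have : r ^ 2 ≠ 0 := pow_ne_zero 2 (hpos r hr).1.ne'
    exact ContinuousAt.continuousWithinAt (by fun_prop (disch := assumption))
  have heq : ∀ r ∈ Set.uIcc A B, limitKernel x y r s t =
      -(1 / 2) * ((radial d ∘ fun r : ℝ => 2 / r - τ) r * (-2 / r ^ 2)) := by
    intro r hr
    rw [limitKernel_eq_radial (hpos r hr).1]
    simp only [Function.comp]
    ring
  have hc : ContinuousOn (fun r => limitKernel x y r s t) (Set.uIcc A B) := by
    refine ContinuousOn.congr ?_ heq
    exact continuousOn_const.mul ((hcont.comp hfc hmap).mul hinv)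
  refine ⟨hc.intervalIntegrable, ?_⟩
  rw [intervalIntegral.integral_congr heq, intervalIntegral.integral_const_mul,
    intervalIntegral.integral_comp_mul_deriv' (fun r hr => ?_) hinv
      (hcont.mono (by rintro _ ⟨r, hr, rfl⟩; exact hmap r hr)),
    intervalIntegral.integral_symm]
  · ring
  · have h := ((hasDerivAt_inv (hpos r hr).1.ne').const_mul 2).sub_const τ
    refine (h.congr_deriv (by ring)).congr_of_eventuallyEq (Eventually.of_forall fun r => ?_)
    simp [div_eq_mul_inv]

/-! ### Integrated approximation error. -/

lemma continuous_binomialKernel (N : ℕ) (x y : Plane) (s t : ℝ) :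
    Continuous fun r => binomialKernel N x y r s t := by
  unfold binomialKernel binomialKernelCoord
  exact continuous_finsetProd _ fun j _ => continuous_const.mul
    (continuous_binomialCoincidence _ _ (continuous_id.div_const s) (continuous_id.div_const t))

lemma rpow_neg_three_halves {u : ℝ} (hu : 0 < u) : u ^ (-(3 / 2) : ℝ) = (u * √u)⁻¹ := by
  rw [Real.rpow_neg hu.le, Real.sqrt_eq_rpow]
  congr 1
  nth_rewrite 2 [← Real.rpow_one u]
  rw [← Real.rpow_add hu]
  norm_num

lemma integral_rpow_neg_three_halves_le {A B : ℝ} (hA : 0 < A) (hAB : A ≤ B) :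
    ∫ u in A..B, u ^ (-(3 / 2) : ℝ) ≤ 2 * (√A)⁻¹ := by
  rw [integral_rpow (Or.inr ⟨by norm_num, by
    rw [Set.uIcc_of_le hAB]; exact fun h => absurd h.1 (not_le.2 hA)⟩)]
  have h1 : A ^ (-(3 / 2) + 1 : ℝ) = (√A)⁻¹ := by
    rw [Real.sqrt_eq_rpow, ← Real.rpow_neg hA.le]; norm_num
  have h2 : 0 ≤ B ^ (-(3 / 2) + 1 : ℝ) := by
    have := hA.trans_le hAB
    positivity
  rw [h1]
  have : (B ^ (-(3 / 2) + 1 : ℝ) - (√A)⁻¹) / (-(3 / 2) + 1) =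
    2 * ((√A)⁻¹ - B ^ (-(3 / 2) + 1 : ℝ)) := by ring
  rw [this]; linarith

lemma intervalIntegrable_rpow_neg_three_halves {A B : ℝ} (hA : 0 < A) (hAB : A ≤ B) :
    IntervalIntegrable (fun u : ℝ => u ^ (-(3 / 2) : ℝ)) volume A B :=
  intervalIntegral.intervalIntegrable_rpow (Or.inr (by
    rw [Set.uIcc_of_le hAB]; exact fun h => absurd h.1 (not_le.2 hA)))

lemma ell_pos (η : ℝ) {N : ℕ} (hN : 0 < N) : 0 < ell η N := by
  unfold ell
  have : (0 : ℝ) < N := by exact_mod_cast hN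
  positivity

lemma tendsto_ell {η : ℝ} (hη : 0 < η) : Tendsto (ell η) atTop (𝓝 0) :=
  (tendsto_rpow_neg_atTop (by positivity : 0 < 1 / 2 + η)).comp tendsto_natCast_atTop_atTop

lemma inv_sqrt_le_sqrt_ell {η : ℝ} (hη : η < 1 / 2) {N : ℕ} (hN : 0 < N) :
    (√(N : ℝ))⁻¹ ≤ √(ell η N) := by
  rw [← Real.sqrt_inv]
  apply Real.sqrt_le_sqrt
  unfold ell
  rw [← Real.rpow_neg_one]
  exact Real.rpow_le_rpow_of_exponent_le (by exact_mod_cast hN) (by linarith)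

/-- This product, equal to `N^{-(1/4 - η/2)}`, is the order of the integrated approximation error.
-/
lemma tendsto_inv_sqrt_mul_inv_sqrt_ell {η : ℝ} (hη : η < 1 / 2) :
    Tendsto (fun N : ℕ => (√(N : ℝ))⁻¹ * (√(ell η N))⁻¹) atTop (𝓝 0) := by
  have h := (tendsto_rpow_neg_atTop (by linarith : 0 < 1 / 4 - η / 2)).comp
    tendsto_natCast_atTop_atTop
  refine h.congr' ?_
  filter_upwards [eventually_gt_atTop 0] with N hN
  have hN' : (0 : ℝ) < N := by exact_mod_cast hN
  simp only [Function.comp, ell]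
  rw [Real.sqrt_eq_rpow, Real.sqrt_eq_rpow, ← Real.rpow_mul hN'.le, ← Real.rpow_neg hN'.le,
    ← Real.rpow_neg hN'.le, ← Real.rpow_add hN']
  congr 1; ring

/-- Ensures that `N r ≥ 1` eventually holds on the whole range of integration, where the indicator
is then `1`. -/
lemma tendsto_natCast_mul_ell {η : ℝ} (hη : η < 1 / 2) :
    Tendsto (fun N : ℕ => (N : ℝ) * ell η N) atTop atTop := by
  have h := (tendsto_rpow_atTop (by linarith : 0 < 1 / 2 - η)).comp
    tendsto_natCast_atTop_atTop
  refine h.congr' ?_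
  filter_upwards [eventually_gt_atTop 0] with N hN
  have hN' : (0 : ℝ) < N := by exact_mod_cast hN
  simp only [Function.comp, ell]
  nth_rewrite 2 [← Real.rpow_one (N : ℝ)]
  rw [← Real.rpow_add hN']
  congr 1; ring

/-- The binomial kernel may be replaced by its limit under the integral. -/
lemma tendsto_integral_binomialKernel_sub {η s t c : ℝ} {x y : Plane} {B : ℕ → ℝ}
    (hη : η < 1 / 2) (hs : 0 < s) (hst : s ≤ t) (hxy : s < t ∨ x ≠ y)
    (hc : 0 < c) (hB : ∀ᶠ N in atTop, s * ell η N ≤ B N ∧ B N ≤ s ∧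
      ∀ r ∈ Set.Icc (s * ell η N) (B N),
        c * r ≤ r * varRate s t r ∨ c * (s + s * ell η N - r) ≤ r * varRate s t r) :
    Tendsto (fun N => ∫ r in (s * ell η N)..(B N),
      (binomialKernel N x y r s t - limitKernel x y r s t)) atTop (𝓝 0) := by
  obtain ⟨C, hC, hK⟩ := exists_binomialKernel_approx hs hst hxy
    (by positivity : 0 ≤ (√(c * s))⁻¹)
  have hlim : Tendsto (fun N : ℕ => C * (c * √c)⁻¹ * (4 * (√s)⁻¹) *
      ((√(N : ℝ))⁻¹ * (√(ell η N))⁻¹)) atTop (𝓝 0) := by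
    have := (tendsto_inv_sqrt_mul_inv_sqrt_ell hη).const_mul (C * (c * √c)⁻¹ * (4 * (√s)⁻¹))
    rwa [mul_zero] at this
  refine squeeze_zero_norm' ?_ hlim
  filter_upwards [hB, hK, eventually_gt_atTop 0] with N hB hK hN
  obtain ⟨hAB, hBs, hq⟩ := hB
  have hℓ := ell_pos η hN
  set A := s * ell η N with hA
  have hA0 : 0 < A := by positivity
  set ε := (√(N : ℝ))⁻¹ with hε
  have hε0 : 0 ≤ ε := by positivity
  have hcu : ∀ u q : ℝ, 0 < u → c * u ≤ q → (q * √q)⁻¹ ≤ (c * √c)⁻¹ * u ^ (-(3 / 2) : ℝ) := by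
    intro u q hu hcq
    rw [rpow_neg_three_halves hu, ← mul_inv]
    have h1 : c * √c * (u * √u) = (c * u) * √(c * u) := by
      rw [Real.sqrt_mul hc.le]; ring
    rw [h1]
    have hq : 0 ≤ q := (mul_pos hc hu).le.trans hcq
    gcongr
  -- The variance may degenerate at either end of the interval. The sum covers both alternatives of
  -- `hB`; the shift by `A` keeps the second base at least `A`, so each power integrates to at most
  -- `2 / √A`.
  set D : ℝ → ℝ := fun r => r ^ (-(3 / 2) : ℝ) + (s + A - r) ^ (-(3 / 2) : ℝ) with hD
  have hi1 := intervalIntegrable_rpow_neg_three_halves hA0 hAB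
  have hi2 : IntervalIntegrable (fun r => (s + A - r) ^ (-(3 / 2) : ℝ)) volume A (B N) := by
    have h := (intervalIntegrable_rpow_neg_three_halves (by linarith : 0 < s + A - B N)
      (by linarith : s + A - B N ≤ s)).comp_sub_left (s + A)
    simpa using h.symm
  have hbound : ∀ r ∈ Set.Ioc A (B N), ‖binomialKernel N x y r s t - limitKernel x y r s t‖ ≤
      C * ε * (c * √c)⁻¹ * D r := by
    intro r hr
    have hr0 : 0 < r := hA0.trans hr.1
    have hrs : r ≤ s := hr.2.trans hBs
    have hu0 : A ≤ s + A - r := by linarith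
    have hp1 : 0 ≤ r ^ (-(3 / 2) : ℝ) := by positivity
    have hp2 : 0 ≤ (s + A - r) ^ (-(3 / 2) : ℝ) := Real.rpow_nonneg (by linarith) _
    have hcc : 0 ≤ (c * √c)⁻¹ := by positivity
    have hor := hq r ⟨hr.1.le, hr.2⟩
    have hqA : c * A ≤ r * varRate s t r := by
      rcases hor with h | h
      · exact (mul_le_mul_of_nonneg_left hr.1.le hc.le).trans h
      · exact (mul_le_mul_of_nonneg_left hu0 hc.le).trans h
    have hσ : 0 < varRate s t r := by
      have : 0 < r * varRate s t r := (mul_pos hc hA0).trans_le hqA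
      exact pos_of_mul_pos_right this hr0.le
    have hεq : ε ≤ (√(c * s))⁻¹ * √(r * varRate s t r) := by
      calc ε ≤ √(ell η N) := inv_sqrt_le_sqrt_ell hη hN
        _ = (√(c * s))⁻¹ * √(c * A) := by
          rw [hA, ← mul_assoc, Real.sqrt_mul (by positivity : 0 ≤ c * s) (ell η N),
            inv_mul_cancel_left₀ (by positivity)]
        _ ≤ _ := by gcongr
    have hqD : (r * varRate s t r * √(r * varRate s t r))⁻¹ ≤ (c * √c)⁻¹ * D r := by
      rcases hor with h | h
      · refine (hcu r _ hr0 h).trans (mul_le_mul_of_nonneg_left ?_ hcc)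
        simp only [hD]; linarith
      · refine (hcu _ _ (by linarith) h).trans (mul_le_mul_of_nonneg_left ?_ hcc)
        simp only [hD]; linarith
    refine (hK r hr0 hrs hσ hεq).trans ?_
    rw [div_eq_mul_inv, mul_assoc (C * ε)]
    gcongr
  have hDle : ∫ r in A..(B N), D r ≤ 4 * (√A)⁻¹ := by
    simp only [hD]
    rw [intervalIntegral.integral_add hi1 hi2,
      intervalIntegral.integral_comp_sub_left (fun u => u ^ (-(3 / 2) : ℝ)) (s + A)]
    have h1 := integral_rpow_neg_three_halves_le hA0 hAB
    have h2 := integral_rpow_neg_three_halves_le (by linarith : 0 < s + A - B N)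
      (by linarith : s + A - B N ≤ s + A - A)
    have h3 : (√(s + A - B N))⁻¹ ≤ (√A)⁻¹ := by gcongr; linarith
    linarith
  refine (intervalIntegral.norm_integral_le_of_norm_le hAB (ae_of_all _ hbound)
    ((hi1.add hi2).const_mul _)).trans ?_
  rw [intervalIntegral.integral_const_mul]
  calc _ ≤ C * ε * (c * √c)⁻¹ * (4 * (√A)⁻¹) := by gcongr
    _ = _ := by rw [hA, Real.sqrt_mul hs.le, mul_inv]; ring

/-! ### Passage to the limit. -/

lemma integral_averagedLogKernel {τ d W : ℝ} (hτ : 0 < τ) (hW : 2 ≤ W) :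
    ∫ w in (0 : ℝ)..W, averagedLogKernel τ d w =
      1 / 2 * (∫ w in τ..(τ + W), radial d w) - Real.log (W / 2) / (4 * Real.pi) := by
  have hpi := Real.pi_pos
  have hr : IntervalIntegrable (fun w => 1 / 2 * radial d (τ + w)) volume 0 W := by
    refine ContinuousOn.intervalIntegrable fun w hw => ?_
    rw [Set.uIcc_of_le (by linarith)] at hw
    exact ContinuousAt.continuousWithinAt (continuousAt_const.mul
      (ContinuousAt.comp (f := fun w => τ + w) (continuousAt_radial d (by linarith [hw.1]))
        (by fun_prop)))
  have e : (fun w => indicatorGeOne (w / 2) / (4 * Real.pi * w)) =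
      Set.indicator (Set.Ici 2) fun w => 1 / (4 * Real.pi) * (1 / w) := by
    ext w
    by_cases h : 2 ≤ w
    · rw [indicatorGeOne_of_le (by linarith), Set.indicator_of_mem (Set.mem_Ici.2 h),
        one_div_mul_one_div]
    · rw [indicatorGeOne_of_lt (by linarith), Set.indicator_of_notMem (by simpa using h), zero_div]
  have hsub : Set.Ioc 0 W ∩ Set.Ici 2 = Set.Icc 2 W := by
    ext w; simp only [Set.mem_inter_iff, Set.mem_Ioc, Set.mem_Ici, Set.mem_Icc]
    constructor
    · rintro ⟨⟨_, h2⟩, h3⟩; exact ⟨h3, h2⟩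
    · rintro ⟨h1, h2⟩; exact ⟨⟨by linarith, h2⟩, h1⟩
  have hint : IntegrableOn (fun w : ℝ => 1 / (4 * Real.pi) * (1 / w)) (Set.Icc 2 W) := by
    refine ContinuousOn.integrableOn_Icc fun w hw => ContinuousAt.continuousWithinAt ?_
    have : w ≠ 0 := by have := hw.1; intro h; linarith
    fun_prop (disch := assumption)
  have hi : IntervalIntegrable (fun w => indicatorGeOne (w / 2) / (4 * Real.pi * w)) volume 0 W := by
    rw [e, intervalIntegrable_iff_integrableOn_Ioc_of_le (by linarith), IntegrableOn,
      integrable_indicator_iff measurableSet_Ici, IntegrableOn,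
      Measure.restrict_restrict measurableSet_Ici, Set.inter_comm, hsub]
    exact hint
  unfold averagedLogKernel
  rw [intervalIntegral.integral_sub hr hi, intervalIntegral.integral_const_mul,
    intervalIntegral.integral_comp_add_left (radial d) τ, add_zero, e,
    intervalIntegral.integral_of_le (by linarith : (0 : ℝ) ≤ W),
    setIntegral_indicator measurableSet_Ici, hsub, integral_Icc_eq_integral_Ioc,
    ← intervalIntegral.integral_of_le hW, intervalIntegral.integral_const_mul,
    integral_one_div_of_pos two_pos (by linarith)]
  ring

/-- The limit of the centered integrals, for upper limits of integration that converge to `s`. -/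
lemma tendsto_integral_centeredKernel {η s t c : ℝ} {x y : Plane} {B : ℕ → ℝ} (hη0 : 0 < η)
    (hη : η < 1 / 2) (hs : 0 < s) (hst : s ≤ t) (hxy : s < t ∨ x ≠ y)
    (hc : 0 < c) (hB : ∀ᶠ N in atTop, s * ell η N ≤ B N ∧ B N ≤ s ∧
      ∀ r ∈ Set.Icc (s * ell η N) (B N),
        c * r ≤ r * varRate s t r ∨ c * (s + s * ell η N - r) ≤ r * varRate s t r)
    (hBs : Tendsto B atTop (𝓝 s)) :
    Tendsto (fun N : ℕ => (∫ r in (s * ell η N)..(B N), centeredKernel N x y s t r)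
        + Real.log s / (4 * Real.pi) - ∫ v in Set.Ioi (0 : ℝ), constIntegrand v)
      atTop
      (𝓝 ((1 / (2 * Real.pi)) * (∫ y' : Plane, ∫ y'' : Plane, logIntegrand s t x y y' y'')
        + ∫ r in (0 : ℝ)..(1 / t), ∫ z : Plane, heatIntegrand s t x y r z)) := by
  have hpi := Real.pi_pos
  have ht : 0 < t := hs.trans_le hst
  have hts : 1 / t ≤ 1 / s := one_div_le_one_div_of_le hs hst
  have ht0 : 0 < 1 / t := by positivity
  rw [(integrable_and_integral_logIntegrand hs ht x y).2,
    (integrable_and_integral_heatIntegrand hs hst hxy).2]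
  set τ := 1 / s + 1 / t with hτ
  set δ := 1 / s - 1 / t with hδ
  set d := ‖x - y‖ ^ 2 with hd
  set C₀ := ∫ v in Set.Ioi (0 : ℝ), constIntegrand v with hC₀
  have hd0 : 0 ≤ d := by positivity
  have hδ0 : 0 ≤ δ := by linarith
  have hδτ : δ ≤ τ := by linarith
  have hτ0 : 0 < τ := by positivity
  have hcont : ContinuousOn (radial d) (Set.Ici δ) := by
    refine continuousOn_radial hδ0 ?_
    rcases hxy with h | h
    · left; rw [hδ, sub_pos]; exact one_div_lt_one_div_of_lt hs h
    · right
      have : 0 < ‖x - y‖ := norm_pos_iff.2 (sub_ne_zero.2 h)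
      positivity
  have hII : ∀ a b : ℝ, δ ≤ a → δ ≤ b → IntervalIntegrable (radial d) volume a b :=
    fun a b ha hb => (hcont.mono fun w hw => (le_min ha hb).trans hw.1).intervalIntegrable
  have hA : Tendsto (fun N => s * ell η N) atTop (𝓝 0) := by
    have := (tendsto_ell hη0).const_mul s
    rwa [mul_zero] at this
  have hApos : ∀ᶠ N in atTop, 0 < s * ell η N := by
    filter_upwards [eventually_gt_atTop 0] with N hN
    exact mul_pos hs (ell_pos η hN)
  have hW : Tendsto (fun N => 2 / (s * ell η N)) atTop atTop := by
    have : Tendsto (fun N => s * ell η N) atTop (𝓝[>] 0) :=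
      tendsto_nhdsWithin_iff.2 ⟨hA, hApos⟩
    exact (this.inv_tendsto_nhdsGT_zero).const_mul_atTop two_pos
  have herr := tendsto_integral_binomialKernel_sub hη hs hst hxy hc hB
  have hψ : Tendsto (fun N => ∫ w in (0 : ℝ)..(2 / (s * ell η N)), averagedLogKernel τ d w) atTop
      (𝓝 (∫ w in Set.Ioi 0, averagedLogKernel τ d w)) :=
    intervalIntegral_tendsto_integral_Ioi 0 (integrableOn_averagedLogKernel hτ0 hd0) hW
  -- The part of the time integral lost because the upper limit is `B N` rather than `s`.
  have hlow : Tendsto (fun N => ∫ w in δ..(2 / B N - τ), radial d w) atTop (𝓝 0) := by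
    obtain ⟨M, hM⟩ := (isCompact_Icc (a := δ) (b := δ + 1)).exists_bound_of_continuousOn
      (hcont.mono Set.Icc_subset_Ici_self)
    have hl : Tendsto (fun N => 2 / B N - τ) atTop (𝓝 δ) := by
      have h1 : Tendsto (fun N => 2 / B N - τ) atTop (𝓝 (2 / s - τ)) :=
        (tendsto_const_nhds.div hBs hs.ne').sub_const τ
      have : 2 / s - τ = δ := by rw [hτ, hδ]; ring
      rwa [this] at h1
    have hb : Tendsto (fun N => M * |2 / B N - τ - δ|) atTop (𝓝 0) := by
      have := ((hl.sub_const δ).abs).const_mul M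
      simpa using this
    refine squeeze_zero_norm' ?_ hb
    filter_upwards [hl.eventually (gt_mem_nhds (by linarith : δ < δ + 1)), hB, hApos]
      with N hN hB hA
    have hBpos : 0 < B N := hA.trans_le hB.1
    have hge : δ ≤ 2 / B N - τ := by
      have h2 : 2 / s ≤ 2 / B N := by gcongr; exact hB.2.1
      have e : 2 / s = 1 / s + 1 / s := by ring
      rw [hδ, hτ]; linarith
    refine intervalIntegral.norm_integral_le_of_norm_le_const fun w hw => hM w ?_
    rw [Set.uIoc_of_le hge] at hw
    exact ⟨hw.1.le, hw.2.trans hN.le⟩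
  -- With `W = 2 / (s ℓ_N)`, the substitution ends at time `W - τ`, whereas the averaged kernel
  -- integrated up to `W` reaches `W + τ`. The window has fixed length and the integrand there is
  -- `O(1 / W)`.
  have hhigh : Tendsto (fun N => ∫ w in (2 / (s * ell η N) - τ)..(2 / (s * ell η N) + τ),
      radial d w) atTop (𝓝 0) := by
    have hW' : Tendsto (fun N => 2 / (s * ell η N) - τ) atTop atTop :=
      tendsto_atTop_add_const_right _ (-τ) hW
    have hb : Tendsto (fun N => (2 / (s * ell η N) - τ)⁻¹ * |2 * τ|) atTop (𝓝 0) := by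
      have := hW'.inv_tendsto_atTop.mul_const |2 * τ|
      simpa using this
    refine squeeze_zero_norm' ?_ hb
    filter_upwards [hW'.eventually_gt_atTop 0] with N hN
    have e : 2 / (s * ell η N) + τ - (2 / (s * ell η N) - τ) = 2 * τ := by ring
    rw [← e]
    refine intervalIntegral.norm_integral_le_of_norm_le_const fun w hw => ?_
    rw [Set.uIoc_of_le (by linarith)] at hw
    have hw0 : 0 < w := hN.trans hw.1
    rw [Real.norm_of_nonneg (radial_nonneg hw0.le)]
    refine (radial_le hd0 hw0).trans ?_
    rw [one_div]
    apply inv_anti₀ hN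
    nlinarith [Real.pi_gt_three, hw.1]
  have hlog : Tendsto (fun N => Real.log (B N)) atTop (𝓝 (Real.log s)) :=
    (Real.continuousAt_log hs.ne').tendsto.comp hBs
  -- For large `N` this expression equals the centred integral with its constants exactly; every
  -- term has a known limit.
  have hmain : Tendsto (fun N : ℕ =>
      (∫ r in (s * ell η N)..(B N), (binomialKernel N x y r s t - limitKernel x y r s t)) +
      1 / 2 * (∫ w in δ..τ, radial d w) +
      (∫ w in (0 : ℝ)..(2 / (s * ell η N)), averagedLogKernel τ d w) -
      1 / 2 * (∫ w in δ..(2 / B N - τ), radial d w) -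
      1 / 2 * (∫ w in (2 / (s * ell η N) - τ)..(2 / (s * ell η N) + τ), radial d w) -
      (Real.log (B N) - Real.log s) / (4 * Real.pi) - C₀) atTop
      (𝓝 ((∫ w in Set.Ioi 0, averagedLogKernel τ d w) - C₀ + 1 / 2 * ∫ w in δ..τ, radial d w)) := by
    have := ((((((herr.add_const (1 / 2 * (∫ w in δ..τ, radial d w))).add hψ).sub
      (hlow.const_mul (1 / 2))).sub (hhigh.const_mul (1 / 2))).sub
      ((hlog.sub_const (Real.log s)).div_const (4 * Real.pi))).sub_const C₀)
    refine this.trans (le_of_eq ?_)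
    congr 1
    ring
  refine hmain.congr' ?_
  filter_upwards [hB, hApos, hW.eventually_ge_atTop 2, hW.eventually_ge_atTop (2 * τ),
    ((tendsto_natCast_mul_ell hη).const_mul_atTop hs).eventually_ge_atTop 1]
    with N hB hA hW2 hWτ hNA
  obtain ⟨hAB, hBs, -⟩ := hB
  set A := s * ell η N with hAdef
  have hBpos : 0 < B N := hA.trans_le hAB
  obtain ⟨hli, hlint⟩ := integral_limitKernel (t := t) (x := x) (y := y) hA hAB hBs hcont
  rw [← hτ, ← hd] at hlint
  have hbi : IntervalIntegrable (fun r => binomialKernel N x y r s t) volume A (B N) :=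
    (continuous_binomialKernel N x y s t).intervalIntegrable _ _
  have hsing : IntervalIntegrable (fun r : ℝ => 1 / (4 * Real.pi) * (1 / r)) volume A (B N) := by
    refine ContinuousOn.intervalIntegrable fun r hr => ContinuousAt.continuousWithinAt ?_
    rw [Set.uIcc_of_le hAB] at hr
    have : r ≠ 0 := (hA.trans_le hr.1).ne'
    fun_prop (disch := assumption)
  have hcent : ∫ r in A..(B N), centeredKernel N x y s t r =
      (∫ r in A..(B N), (binomialKernel N x y r s t - limitKernel x y r s t)) +
        (∫ r in A..(B N), limitKernel x y r s t) -
        1 / (4 * Real.pi) * (Real.log (B N) - Real.log A) := by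
    have e : ∀ r ∈ Set.uIcc A (B N), centeredKernel N x y s t r =
        binomialKernel N x y r s t - 1 / (4 * Real.pi) * (1 / r) := by
      intro r hr
      rw [Set.uIcc_of_le hAB] at hr
      have h1 : 1 ≤ (N : ℝ) * r := by
        refine hNA.trans ?_
        calc s * ((N : ℝ) * ell η N) = N * A := by rw [hAdef]; ring
          _ ≤ N * r := by gcongr; exact hr.1
      rw [centeredKernel, indicatorGeOne_of_le h1, one_div_mul_one_div]
    rw [intervalIntegral.integral_congr e, intervalIntegral.integral_sub hbi hsing,
      intervalIntegral.integral_sub hbi hli, intervalIntegral.integral_const_mul,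
      integral_one_div_of_pos hA hBpos, Real.log_div hBpos.ne' hA.ne']
    ring
  have hge : δ ≤ 2 / B N - τ := by
    have h2 : 2 / s ≤ 2 / B N := by gcongr
    have e : 2 / s = 1 / s + 1 / s := by ring
    rw [hδ, hτ]; linarith
  have hWd : δ ≤ 2 / A - τ := by linarith
  have hWd' : δ ≤ 2 / A + τ := by linarith
  have hadd1 := intervalIntegral.integral_add_adjacent_intervals (hII δ _ le_rfl hge)
    (hII _ (2 / A - τ) hge hWd)
  have hadd2 := intervalIntegral.integral_add_adjacent_intervals (hII δ _ le_rfl hWd)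
    (hII _ (2 / A + τ) hWd hWd')
  have hadd3 := intervalIntegral.integral_add_adjacent_intervals (hII δ τ le_rfl hδτ)
    (hII _ (2 / A + τ) hδτ hWd')
  have hlogA : Real.log (2 / A / 2) = -Real.log A := by
    rw [← Real.log_inv]; congr 1; field_simp
  rw [hcent, hlint, integral_averagedLogKernel hτ0 hW2, hlogA, add_comm τ (2 / A)]
  rw [← hadd1] at hadd2
  rw [← hadd2] at hadd3
  linear_combination (1 / 2) * hadd3

end IntegratedNormal

theorem theorem3p20 (η : ℝ) (hη0 : 0 < η) (hη1 : η < 1 / 2) :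
    IntegrableOn IntegratedNormal.constIntegrand (Set.Ioi 0) ∧
    ∀ (s t : ℝ) (x y : IntegratedNormal.Plane), 0 < s → s ≤ t → (s < t ∨ x ≠ y) →
      -- the integrals of the limit converge absolutely
      Integrable (fun p : IntegratedNormal.Plane × IntegratedNormal.Plane =>
        IntegratedNormal.logIntegrand s t x y p.1 p.2) ∧
      IntegrableOn (fun p : ℝ × IntegratedNormal.Plane =>
        IntegratedNormal.heatIntegrand s t x y p.1 p.2) (Set.Ioo 0 (1 / t) ×ˢ Set.univ) ∧
      -- the case `s < t`: integration up to `s`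
      (s < t →
        Tendsto (fun N : ℕ =>
            (∫ r in (s * IntegratedNormal.ell η N)..s,
              IntegratedNormal.centeredKernel N x y s t r)
            + Real.log s / (4 * Real.pi)
            - ∫ v in Set.Ioi (0 : ℝ), IntegratedNormal.constIntegrand v)
          atTop
          (𝓝 ((1 / (2 * Real.pi)) *
              (∫ y' : IntegratedNormal.Plane, ∫ y'' : IntegratedNormal.Plane,
                IntegratedNormal.logIntegrand s t x y y' y'')
            + ∫ r in (0 : ℝ)..(1 / t), ∫ z : IntegratedNormal.Plane,
                IntegratedNormal.heatIntegrand s t x y r z))) ∧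
      -- the case `s = t`, `x ≠ y`: integration up to `s * r_N`
      (s = t →
        Tendsto (fun N : ℕ =>
            (∫ r in (s * IntegratedNormal.ell η N)..(s * IntegratedNormal.rN η N),
              IntegratedNormal.centeredKernel N x y s t r)
            + Real.log s / (4 * Real.pi)
            - ∫ v in Set.Ioi (0 : ℝ), IntegratedNormal.constIntegrand v)
          atTop
          (𝓝 ((1 / (2 * Real.pi)) *
              (∫ y' : IntegratedNormal.Plane, ∫ y'' : IntegratedNormal.Plane,
                IntegratedNormal.logIntegrand s t x y y' y'')
            + ∫ r in (0 : ℝ)..(1 / t), ∫ z : IntegratedNormal.Plane,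
                IntegratedNormal.heatIntegrand s t x y r z))) := by
  refine ⟨IntegratedNormal.integrableOn_constIntegrand, fun s t x y hs hst hxy => ?_⟩
  have ht : 0 < t := hs.trans_le hst
  have hℓ := IntegratedNormal.tendsto_ell hη0
  refine ⟨(IntegratedNormal.integrable_and_integral_logIntegrand hs ht x y).1,
    (IntegratedNormal.integrable_and_integral_heatIntegrand hs hst hxy).1, fun hlt => ?_,
    fun heq => ?_⟩
  -- For `r ≤ s` the rate `varRate s t r` is at least `1 - s / t`, so the first alternative always
  -- holds.
  · have hc : 0 < 1 - s / t := by rw [sub_pos, div_lt_one ht]; exact hlt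
    refine IntegratedNormal.tendsto_integral_centeredKernel (B := fun _ => s) hη0 hη1 hs hst hxy
      hc ?_ tendsto_const_nhds
    filter_upwards [hℓ.eventually (gt_mem_nhds one_pos), eventually_gt_atTop 0] with N hN hN0
    refine ⟨by nlinarith, le_rfl, fun r hr => Or.inl ?_⟩
    have hr0 : 0 < r := (mul_pos hs (IntegratedNormal.ell_pos η hN0)).trans_le hr.1
    have h1 : r / s ≤ 1 := (div_le_one hs).2 hr.2
    have h2 : r / t ≤ s / t := by gcongr; exact hr.2
    rw [mul_comm, IntegratedNormal.varRate]
    gcongr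
    linarith
  · subst heq
    refine IntegratedNormal.tendsto_integral_centeredKernel (c := 1 / 2) hη0 hη1 hs hst hxy
      (by norm_num) ?_ ?_
    · filter_upwards [hℓ.eventually (gt_mem_nhds (by norm_num : (0 : ℝ) < 1 / 2)),
        eventually_gt_atTop 0] with N hN hN0
      have hℓ0 := IntegratedNormal.ell_pos η hN0
      have hrN : s * IntegratedNormal.rN η N = s - s * IntegratedNormal.ell η N := by
        rw [IntegratedNormal.rN]; ring
      rw [hrN]
      set A := s * IntegratedNormal.ell η N with hA
      have hA0 : 0 < A := mul_pos hs hℓ0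
      have hAs : A ≤ s / 2 := by rw [hA]; nlinarith
      refine ⟨by linarith, by linarith, fun r hr => ?_⟩
      have hr0 : 0 < r := hA0.trans_le hr.1
      have hv : IntegratedNormal.varRate s s r = 2 * (s - r) / s := by
        rw [IntegratedNormal.varRate]; field_simp; ring
      rw [hv]
      have e : r * (2 * (s - r) / s) = 2 * (r * (s - r)) / s := by ring
      rw [e]
      -- For `r ≤ s / 2` the variance is at least `r`. Otherwise it is at least `s - r`, and `s - r
      -- ≥ A` on the truncated range gives `s - r ≥ (s + A - r) / 2`, hence the constant `1 / 2`.
      rcases le_total r (s / 2) with h | h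
      · left
        rw [le_div_iff₀ hs]
        nlinarith
      · right
        rw [le_div_iff₀ hs]
        have h1 : A ≤ s - r := by linarith [hr.2]
        nlinarith
    · have := (hℓ.const_sub 1).const_mul s
      simpa [IntegratedNormal.rN] using this
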